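/- A coincidence isometry of $\mathbb{Z}^3\subset\mathbb{R}^3$ is an orthogonal transformation $R\in\mathrm{O}(3,\mathbb{R})$ such that $\mathbb{Z}^3\cap R\mathbb{Z}^3$ has finite index in both $\mathbb{Z}^3$ and $R\mathbb{Z}^3$; the group $\mathbb{Z}^3\cap R\mathbb{Z}^3$ is then called a coincidence site lattice (CSL) of $\mathbb{Z}^3$, and its index is $[\mathbb{Z}^3:\mathbb{Z}^3\cap R\mathbb{Z}^3]$. For each $m\ge 1$, let $f(m)$ be the number of different CSLs of $\mathbb{Z}^3$ of index $m$. Then every $f(m)$ is finite, and $f$ is multiplicative, i.e. $f(1)=1$ and $f(mn)=f(m)f(n)$ for all coprime $m,n\ge 1$. Moreover, $f(2n)=0$ for all $n\ge 1$, and $f(p^r)=(p+1)p^{r-1}$ for all odd primes $p$ and all $r\ge 1$. For every $s\in\mathbb{C}$ with $\operatorname{Re}(s)>2$, the Dirichlet series of $f$ converges absolutely, the product below over all odd primes converges unconditionally, and \[ \sum_{m=1}^{\infty}\frac{f(m)}{m^s} =\prod_{p\neq 2}\frac{1+p^{-s}}{1-p^{1-s}} =\frac{1-2^{1-s}}{1+2^{-s}}\cdot\frac{\zeta(s)\,\zeta(s-1)}{\zeta(2s)}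 . \] The series begins \[ 1+\tfrac{4}{3^s}+\tfrac{6}{5^s}+\tfrac{8}{7^s}+\tfrac{12}{9^s}+\tfrac{12}{11^s}+\tfrac{14}{13^s}+\tfrac{24}{15^s}+\tfrac{18}{17^s}+\tfrac{20}{19^s}+\tfrac{32}{21^s}+\tfrac{24}{23^s}+\tfrac{30}{25^s}+\cdots . \] -/

import Mathlib

/-- The lattice `ℤ^d = ℤ e₁ ⊕ ⋯ ⊕ ℤ e_d` in Euclidean `d`-space. -/
noncomputable def integerLattice (d : ℕ) : AddSubgroup (EuclideanSpace ℝ (Fin d)) :=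
  AddSubgroup.closure (Set.range fun i : Fin d => EuclideanSpace.single i (1 : ℝ))

/-- The image `R Γ` of a subgroup `Γ` of Euclidean space under an orthogonal transformation `R`. -/
noncomputable def rotatedCopy {d : ℕ} (R : EuclideanSpace ℝ (Fin d) ≃ₗᵢ[ℝ] EuclideanSpace ℝ (Fin d))
    (Γ : AddSubgroup (EuclideanSpace ℝ (Fin d))) : AddSubgroup (EuclideanSpace ℝ (Fin d)) :=
  Γ.map R.toLinearEquiv.toLinearMap.toAddMonoidHom

/-- `R ∈ O(d)` is a coincidence isometry of `Γ` if `Γ ∩ R Γ` has finite index both in `R Γ`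
and in `Γ`. -/
def IsCoincidenceIsometry {d : ℕ} (Γ : AddSubgroup (EuclideanSpace ℝ (Fin d)))
    (R : EuclideanSpace ℝ (Fin d) ≃ₗᵢ[ℝ] EuclideanSpace ℝ (Fin d)) : Prop :=
  (rotatedCopy R Γ).Commensurable Γ

/-- The coincidence site lattices (CSLs) of `Γ` of index `m`: the subgroups `Γ ∩ R Γ`, with `R` a
coincidence isometry of `Γ`, whose index in `Γ` is `m`. -/
def cslsOfIndex {d : ℕ} (Γ : AddSubgroup (EuclideanSpace ℝ (Fin d))) (m : ℕ) :
    Set (AddSubgroup (EuclideanSpace ℝ (Fin d))) :=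
  {Λ | (∃ R : EuclideanSpace ℝ (Fin d) ≃ₗᵢ[ℝ] EuclideanSpace ℝ (Fin d),
      IsCoincidenceIsometry Γ R ∧ Λ = Γ ⊓ rotatedCopy R Γ) ∧ Λ.relIndex Γ = m}

/-- `cubicCSLCount m` is the number `f(m)` of different CSLs of `ℤ³` of index `m`. -/
noncomputable def cubicCSLCount (m : ℕ) : ℕ :=
  (cslsOfIndex (integerLattice 3) m).ncard

/-! The CSLs of odd index `m` are the lattices of integer vectors orthogonal modulo `m` to a
primitive isotropic vector `v` of `x² + y² + z²` over `ℤ/m`; there are none of even index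
(`cslsOfIndex_eq_image`, `cslsOfIndex_eq_empty`).

Every such `v` occurs: if `v ⬝ᵥ v = m * q`, the sublattice is the intersection of `ℤ³` with a
neighbour lattice. Reducing `v` modulo `m` makes `q < m`, and the reflection in `v` exchanges `m`
and `q`, so a descent shows that the neighbour is a rotated `ℤ³`
(`exists_rotatedCopy_eq_neighbourLattice`). Conversely, let `M = nR` be integral with `n` minimal.
Then `MᵀM = n²` forces `n` odd and all 2×2 minors of `M` divisible by `n`. So `M` has rank one
modulo `n`, and its column direction is `v` (`exists_orthogonalSublattice_eq`).

Two vectors give the same sublattice exactly when they differ by a unit, so `f(m) φ(m)` counts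
primitive isotropic vectors. The Chinese remainder theorem yields multiplicativity. Modulo an odd
prime power, `-1` is a sum of two squares, which turns the form into the conic `x * y = z²`, where
counting is immediate. The Euler product and the zeta formula then follow from geometric series. -/

open scoped Matrix ArithmeticFunction.sigma

/-! ### The integer lattice and its rotated copies -/

/-- The inclusion of `ℤ³` into Euclidean space. -/
noncomputable def ofIntVec : (Fin 3 → ℤ) →+ EuclideanSpace ℝ (Fin 3) where
  toFun x := WithLp.toLp 2 fun i => (x i : ℝ)
  map_zero' := by ext i; simp
  map_add' x y := by ext i; simp

@[simp] theorem ofIntVec_apply (x : Fin 3 → ℤ) (i : Fin 3) : ofIntVec x i = x i := rfl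

theorem ofIntVec_injective : Function.Injective ofIntVec := fun x y h => by
  ext i
  have := congrArg (fun z : EuclideanSpace ℝ (Fin 3) => z i) h
  simpa using this

theorem inner_ofIntVec (x y : Fin 3 → ℤ) :
    inner ℝ (ofIntVec x) (ofIntVec y) = ((x ⬝ᵥ y : ℤ) : ℝ) := by
  simp [PiLp.inner_apply, dotProduct, Fin.sum_univ_three, mul_comm]

theorem norm_sq_ofIntVec (x : Fin 3 → ℤ) : ‖ofIntVec x‖ ^ 2 = ((x ⬝ᵥ x : ℤ) : ℝ) := by
  rw [← inner_ofIntVec, real_inner_self_eq_norm_sq]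

theorem ofIntVec_zsmul (k : ℤ) (x : Fin 3 → ℤ) : ofIntVec (k • x) = (k : ℝ) • ofIntVec x := by
  rw [map_zsmul, Int.cast_smul_eq_zsmul]

theorem integerLattice_three : integerLattice 3 = ofIntVec.range := by
  apply le_antisymm
  · rw [integerLattice, AddSubgroup.closure_le]
    rintro _ ⟨i, rfl⟩
    refine ⟨Pi.single i 1, ?_⟩
    ext j
    by_cases h : j = i <;> simp [h]
  · rintro _ ⟨x, rfl⟩
    have : ofIntVec x = ∑ i, x i • (EuclideanSpace.single i (1 : ℝ) : EuclideanSpace ℝ (Fin 3)) := by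
      ext j
      fin_cases j <;> simp [Fin.sum_univ_three]
    rw [this]
    refine sum_mem fun i _ => zsmul_mem (AddSubgroup.subset_closure ?_) _
    exact ⟨i, rfl⟩

theorem mem_integerLattice {y : EuclideanSpace ℝ (Fin 3)} :
    y ∈ integerLattice 3 ↔ ∃ x, ofIntVec x = y := by
  rw [integerLattice_three]; rfl

theorem mem_rotatedCopy {d : ℕ} {R : EuclideanSpace ℝ (Fin d) ≃ₗᵢ[ℝ] EuclideanSpace ℝ (Fin d)}
    {Γ : AddSubgroup (EuclideanSpace ℝ (Fin d))} {y : EuclideanSpace ℝ (Fin d)} :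
    y ∈ rotatedCopy R Γ ↔ R.symm y ∈ Γ := by
  constructor
  · rintro ⟨x, hx, rfl⟩
    simpa using hx
  · intro h
    exact ⟨_, h, by simp⟩

theorem rotatedCopy_trans {d : ℕ} (R S : EuclideanSpace ℝ (Fin d) ≃ₗᵢ[ℝ] EuclideanSpace ℝ (Fin d))
    (Γ : AddSubgroup (EuclideanSpace ℝ (Fin d))) :
    rotatedCopy (R.trans S) Γ = rotatedCopy S (rotatedCopy R Γ) := by
  ext y
  simp [mem_rotatedCopy]

/-! ### Neighbour lattices and reflections -/

/-- For `v ⬝ᵥ v = m * q`, the neighbour of `ℤ³` in direction `v` at distance `m`: the vectors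
`x + (j / m) v` with `x ∈ ℤ³` and `m ∣ 2 (v ⬝ᵥ x) + j q`. -/
noncomputable def neighbourLattice (v : Fin 3 → ℤ) (m q : ℤ) :
    AddSubgroup (EuclideanSpace ℝ (Fin 3)) where
  carrier := {y | ∃ (x : Fin 3 → ℤ) (j : ℤ),
    y = ofIntVec x + (j / m : ℝ) • ofIntVec v ∧ m ∣ 2 * (v ⬝ᵥ x) + j * q}
  zero_mem' := ⟨0, 0, by simp, by simp⟩
  add_mem' := by
    rintro _ _ ⟨x, j, rfl, c, hc⟩ ⟨x', j', rfl, c', hc'⟩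
    refine ⟨x + x', j + j', ?_, c + c', ?_⟩
    · push_cast [map_add, add_div, add_smul]; abel
    · rw [dotProduct_add]; linear_combination hc + hc'
  neg_mem' := by
    rintro _ ⟨x, j, rfl, c, hc⟩
    refine ⟨-x, -j, ?_, -c, ?_⟩
    · push_cast [map_neg, neg_div, neg_smul]; abel
    · rw [dotProduct_neg]; linear_combination -hc

/-- Since `(j / m)(v + m z) = (j / m) v + j z`, the extra term is absorbed into the integral part.
The third argument is the value of `q` belonging to the new vector. -/
theorem neighbourLattice_add_le {v : Fin 3 → ℤ} {m q : ℤ} (hm : m ≠ 0) (z : Fin 3 → ℤ) :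
    neighbourLattice (v + m • z) m (q + 2 * (v ⬝ᵥ z) + m * (z ⬝ᵥ z)) ≤ neighbourLattice v m q := by
  have hm' : (m : ℝ) ≠ 0 := mod_cast hm
  rintro _ ⟨x, j, rfl, c, hc⟩
  refine ⟨x + j • z, j, ?_, ⟨c - 2 * (z ⬝ᵥ x) - j * (z ⬝ᵥ z), ?_⟩⟩
  · rw [map_add, map_add, ofIntVec_zsmul, ofIntVec_zsmul, smul_add, smul_smul, div_mul_cancel₀ _ hm']
    abel
  · simp only [add_dotProduct, smul_dotProduct, dotProduct_add, dotProduct_smul, smul_eq_mul] at hc ⊢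
    linear_combination hc

theorem neighbourLattice_add {v : Fin 3 → ℤ} {m q : ℤ} (hm : m ≠ 0) (z : Fin 3 → ℤ) :
    neighbourLattice (v + m • z) m (q + 2 * (v ⬝ᵥ z) + m * (z ⬝ᵥ z)) = neighbourLattice v m q := by
  refine le_antisymm (neighbourLattice_add_le hm z) ?_
  have := neighbourLattice_add_le (v := v + m • z) (q := q + 2 * (v ⬝ᵥ z) + m * (z ⬝ᵥ z)) hm (-z)
  convert this using 2
  · simp
  · simp only [add_dotProduct, smul_dotProduct, dotProduct_neg, neg_dotProduct, smul_eq_mul]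
    ring

theorem neighbourLattice_smul {v : Fin 3 → ℤ} {m q c : ℤ} (hm : m ≠ 0) (hv : v ⬝ᵥ v = m * q)
    (hc : IsCoprime c m) :
    neighbourLattice (c • v) m (c ^ 2 * q) = neighbourLattice v m q := by
  have hm' : (m : ℝ) ≠ 0 := mod_cast hm
  apply le_antisymm
  · rintro _ ⟨x, j, rfl, k, hk⟩
    refine ⟨x, j * c, ?_, hc.symm.dvd_of_dvd_mul_left ⟨k, ?_⟩⟩
    · rw [ofIntVec_zsmul, smul_smul]; push_cast; congr 2; ring
    · rw [smul_dotProduct, smul_eq_mul] at hk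
      linear_combination hk
  · rintro _ ⟨x, j, rfl, k, hk⟩
    -- From `a c + b m = 1` one gets `(j / m) v = (j a / m)(c v) + j b v`.
    obtain ⟨a, b, hab⟩ := hc
    refine ⟨x + (j * b) • v, j * a, ?_, ⟨c * k + c * j * b * q, ?_⟩⟩
    · rw [ofIntVec_zsmul, map_add, ofIntVec_zsmul, smul_smul, add_assoc, ← add_smul]
      congr 2
      have : (a * c + b * m : ℝ) = 1 := mod_cast hab
      field_simp
      push_cast
      linear_combination -(j : ℝ) * this
    · simp only [smul_dotProduct, dotProduct_add, dotProduct_smul, smul_eq_mul]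
      linear_combination c * hk + (2 * c * j * b) * hv + (j * c * q) * hab

/-- Parity forces `j` to be even on the left and the quotient `c` to be even on the right. In the
descent this moves a factor 2 out of the modulus and keeps the modulus odd. -/
theorem neighbourLattice_two_mul {v : Fin 3 → ℤ} {m k : ℤ} (hm : Odd m) (hk : Odd k) :
    neighbourLattice v (2 * k) m = neighbourLattice v k (2 * m) := by
  have hk0 : (k : ℝ) ≠ 0 := by
    rintro h; rw [Int.cast_eq_zero] at h; subst h; simp at hk
  apply le_antisymm
  · rintro _ ⟨x, j, rfl, c, hc⟩
    have hj : Even j := by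
      have : Even (j * m) := ⟨k * c - v ⬝ᵥ x, by linarith⟩
      rcases Int.even_mul.1 this with h | h
      · exact h
      · exact absurd hm (Int.not_odd_iff_even.2 h)
    obtain ⟨i, rfl⟩ := hj
    refine ⟨x, i, ?_, ⟨2 * c, by linarith⟩⟩
    push_cast; congr 2; field_simp; ring
  · rintro _ ⟨x, j, rfl, c, hc⟩
    have : Even c := by
      have : Even (k * c) := ⟨v ⬝ᵥ x + j * m, by linarith⟩
      rcases Int.even_mul.1 this with h | h
      · exact absurd hk (Int.not_odd_iff_even.2 h)
      · exact h
    obtain ⟨i, rfl⟩ := this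
    refine ⟨x, 2 * j, ?_, ⟨i, by linarith⟩⟩
    push_cast; congr 2; field_simp

/-- The reflection fixes `v` and negates its orthogonal complement. With `2 (v ⬝ᵥ x) + j q = m c`,
it sends `x + (j / m) v` to `-x + (c / q) v`, so `j` and `c` trade places along with `m` and `q`. -/
theorem reflection_mem_neighbourLattice {v : Fin 3 → ℤ} {m q : ℤ} (hm : m ≠ 0) (hq : q ≠ 0)
    (hv : v ⬝ᵥ v = m * q) {y : EuclideanSpace ℝ (Fin 3)} (hy : y ∈ neighbourLattice v m q) :
    (ℝ ∙ ofIntVec v).reflection y ∈ neighbourLattice v q m := by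
  have hm' : (m : ℝ) ≠ 0 := mod_cast hm
  have hq' : (q : ℝ) ≠ 0 := mod_cast hq
  obtain ⟨x, j, rfl, c, hc⟩ := hy
  refine ⟨-x, c, ?_, ⟨j, by rw [dotProduct_neg]; linarith⟩⟩
  rw [Submodule.reflection_singleton_apply, inner_add_right, inner_smul_right, inner_ofIntVec,
    inner_ofIntVec]
  have h2 : ((‖ofIntVec v‖ : ℝ) : ℝ) ^ 2 = m * q := by
    rw [norm_sq_ofIntVec, hv]; push_cast; ring
  have hc' : (2 * (v ⬝ᵥ x : ℤ) + j * q : ℝ) = m * c := mod_cast hc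
  simp only [RCLike.ofReal_real_eq_id, id, h2, map_neg]
  rw [hv, two_smul, ← add_smul, sub_add_eq_sub_sub, sub_right_comm, ← sub_smul, neg_add_eq_sub]
  congr 2
  push_cast
  field_simp
  linear_combination hc'

theorem neighbourLattice_eq_rotatedCopy {v : Fin 3 → ℤ} {m q : ℤ} (hm : m ≠ 0) (hq : q ≠ 0)
    (hv : v ⬝ᵥ v = m * q) :
    neighbourLattice v m q =
      rotatedCopy (ℝ ∙ ofIntVec v).reflection (neighbourLattice v q m) := by
  ext y
  rw [mem_rotatedCopy, Submodule.reflection_symm]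
  refine ⟨reflection_mem_neighbourLattice hm hq hv, fun h => ?_⟩
  have := reflection_mem_neighbourLattice hq hm (by rw [hv, mul_comm]) h
  rwa [Submodule.reflection_reflection] at this

theorem neighbourLattice_one (v : Fin 3 → ℤ) (q : ℤ) :
    neighbourLattice v 1 q = integerLattice 3 := by
  ext y
  rw [mem_integerLattice]
  constructor
  · rintro ⟨x, j, rfl, -⟩
    exact ⟨x + j • v, by rw [map_add, ofIntVec_zsmul]; simp⟩
  · rintro ⟨x, rfl⟩
    exact ⟨x, 0, by simp, one_dvd _⟩

/-! ### Descent: neighbour lattices are rotated copies of `ℤ³` -/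

theorem exists_primitive_of_ne_zero {v : Fin 3 → ℤ} (hv : v ≠ 0) :
    ∃ (c : ℤ) (v₀ w : Fin 3 → ℤ), c ≠ 0 ∧ v = c • v₀ ∧ w ⬝ᵥ v₀ = 1 := by
  obtain ⟨c, hc⟩ := (IsPrincipalIdealRing.principal (Ideal.span (Set.range v))).principal
  rw [Ideal.submodule_span_eq] at hc
  have hdvd : ∀ i, ∃ k, v i = c * k := fun i =>
    Ideal.mem_span_singleton.1 (hc ▸ Ideal.subset_span ⟨i, rfl⟩)
  choose v₀ hv₀ using hdvd
  have hc0 : c ≠ 0 := by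
    rintro rfl
    exact hv (funext fun i => by simp [hv₀])
  obtain ⟨w, hw⟩ := Ideal.mem_span_range_iff_exists_fun.1
    (hc.symm ▸ Ideal.mem_span_singleton_self c : c ∈ Ideal.span (Set.range v))
  refine ⟨c, v₀, w, hc0, funext fun i => by simp [hv₀], ?_⟩
  apply mul_left_cancel₀ hc0
  simp only [dotProduct, Fin.sum_univ_three, hv₀] at hw ⊢
  linear_combination hw

/-- Each coordinate is rounded to a residue of absolute value at most `m / 2`. The descent works
because three squares give a factor `3 / 4 < 1`. -/
theorem exists_reduced (v : Fin 3 → ℤ) {m : ℤ} (hm : 0 < m) :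
    ∃ z : Fin 3 → ℤ, 4 * ((v + m • z) ⬝ᵥ (v + m • z)) ≤ 3 * m ^ 2 := by
  have key : ∀ a : ℤ, ∃ z : ℤ, 4 * ((a + m * z) * (a + m * z)) ≤ m ^ 2 := fun a => by
    have h1 := Int.emod_nonneg (2 * a + m) (by lia : 2 * m ≠ 0)
    have h2 := Int.emod_lt_of_pos (2 * a + m) (by lia : 0 < 2 * m)
    have h3 := Int.emod_add_mul_ediv (2 * a + m) (2 * m)
    refine ⟨-((2 * a + m) / (2 * m)), ?_⟩
    set t := (2 * a + m) / (2 * m)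
    have h4 : -m ≤ 2 * (a + m * -t) := by linarith
    have h5 : 2 * (a + m * -t) ≤ m := by linarith
    nlinarith
  choose z hz using fun i => key (v i)
  refine ⟨z, ?_⟩
  simp only [dotProduct, Fin.sum_univ_three, Pi.add_apply, Pi.smul_apply, smul_eq_mul]
  linarith [hz 0, hz 1, hz 2]

theorem two_dvd_of_four_dvd_dotProduct_self {v : Fin 3 → ℤ} (h : 4 ∣ v ⬝ᵥ v) (i : Fin 3) :
    2 ∣ v i := by
  -- Squares modulo 4 are 0 or 1; `2 * a = 0` in `ZMod 4` encodes that `a` is even.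
  have key : ∀ a b c : ZMod 4, a * a + b * b + c * c = 0 → 2 * a = 0 ∧ 2 * b = 0 ∧ 2 * c = 0 := by
    decide
  have h4 : ((v ⬝ᵥ v : ℤ) : ZMod 4) = 0 := (ZMod.intCast_zmod_eq_zero_iff_dvd _ 4).2 h
  simp only [dotProduct, Fin.sum_univ_three] at h4
  push_cast at h4
  have even : ∀ a : ℤ, 2 * (a : ZMod 4) = 0 → 2 ∣ a := fun a ha => by
    have : (4 : ℤ) ∣ 2 * a := (ZMod.intCast_zmod_eq_zero_iff_dvd _ 4).1 (by push_cast; exact ha)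
    lia
  obtain ⟨h0, h1, h2⟩ := key _ _ _ h4
  fin_cases i
  exacts [even _ h0, even _ h1, even _ h2]

theorem not_four_dvd_dotProduct_self {v w : Fin 3 → ℤ} (h : w ⬝ᵥ v = 1) : ¬ 4 ∣ v ⬝ᵥ v := by
  intro h4
  choose k hk using two_dvd_of_four_dvd_dotProduct_self h4
  have : 2 * (w ⬝ᵥ k) = 1 := by
    rw [← h]
    simp only [dotProduct, Fin.sum_univ_three, hk]
    ring
  lia

/-- Strong induction on the modulus: shorten `v` modulo `m`, divide out its content, then reflect to
replace `m` by the smaller cofactor `q₀`, or by `q₀ / 2` if that is even. -/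
theorem exists_rotatedCopy_eq_neighbourLattice (m : ℕ) (hm : Odd m) (v : Fin 3 → ℤ) (q : ℤ)
    (hv : v ⬝ᵥ v = m * q) (hprim : ∃ w : Fin 3 → ℤ, (m : ℤ) ∣ w ⬝ᵥ v - 1) :
    ∃ R, neighbourLattice v m q = rotatedCopy R (integerLattice 3) := by
  induction m using Nat.strong_induction_on generalizing v q with
  | _ m ih =>
  obtain rfl | hm1 : m = 1 ∨ 1 < m := by have := hm.pos; lia
  · refine ⟨LinearIsometryEquiv.refl ℝ _, ?_⟩
    ext y
    rw [Nat.cast_one, neighbourLattice_one, mem_rotatedCopy]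
    rfl
  have hm0 : (m : ℤ) ≠ 0 := by lia
  have hmpos : (0 : ℤ) < m := by lia
  obtain ⟨z, hz⟩ := exists_reduced v hmpos
  rw [← neighbourLattice_add hm0 z]
  set q' := q + 2 * (v ⬝ᵥ z) + m * (z ⬝ᵥ z) with hq'
  set v' := v + (m : ℤ) • z with hv'
  have hvq : v' ⬝ᵥ v' = m * q' := by
    rw [hv', hq']
    simp only [add_dotProduct, smul_dotProduct, dotProduct_add, dotProduct_smul, smul_eq_mul]
    rw [dotProduct_comm z v]
    linear_combination hv
  obtain ⟨w, t, ht⟩ := hprim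
  have hw : w ⬝ᵥ v' = 1 + m * (t + w ⬝ᵥ z) := by
    rw [hv', dotProduct_add, dotProduct_smul, smul_eq_mul]
    linear_combination ht
  have hv0 : v' ≠ 0 := by
    intro h
    rw [h, dotProduct_zero] at hw
    have : (m : ℤ) ∣ 1 := ⟨-(t + w ⬝ᵥ z), by linear_combination -hw⟩
    have := Int.le_of_dvd one_pos this
    lia
  -- A vector primitive over `ℤ` stays primitive modulo whatever modulus comes next, and its square
  -- norm is not divisible by 4.
  obtain ⟨c, v₀, w₀, hc0, hcv, hw₀⟩ := exists_primitive_of_ne_zero hv0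
  have hcm : IsCoprime c m := ⟨w ⬝ᵥ v₀, -(t + w ⬝ᵥ z), by
    rw [hcv, dotProduct_smul, smul_eq_mul] at hw
    linear_combination hw⟩
  have hcvq : c ^ 2 * (v₀ ⬝ᵥ v₀) = m * q' := by
    rw [← hvq, hcv, smul_dotProduct, dotProduct_smul, smul_eq_mul, smul_eq_mul]; ring
  obtain ⟨q₀, hq₀⟩ : c ^ 2 ∣ q' := hcm.pow_left.dvd_of_dvd_mul_left ⟨_, hcvq.symm⟩
  have hc2 : 0 < c ^ 2 := by positivity
  have hvq₀ : v₀ ⬝ᵥ v₀ = m * q₀ := by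
    apply mul_left_cancel₀ hc2.ne'
    rw [hcvq, hq₀]; ring
  have hv₀0 : v₀ ≠ 0 := by rintro rfl; simp at hw₀
  have hpos : 0 < v₀ ⬝ᵥ v₀ :=
    lt_of_le_of_ne (by simp only [dotProduct, Fin.sum_univ_three]; linarith [mul_self_nonneg (v₀ 0), mul_self_nonneg (v₀ 1),
        mul_self_nonneg (v₀ 2)])
      (Ne.symm (by rwa [Ne, dotProduct_self_eq_zero]))
  have hq₀pos : 0 < q₀ := by
    rw [hvq₀] at hpos; exact pos_of_mul_pos_right hpos hmpos.le
  have hq'lt : q' < m := by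
    rw [hvq] at hz
    nlinarith
  have hq₀lt : q₀ < m := by nlinarith
  rw [hcv, hq₀, neighbourLattice_smul hm0 hvq₀ hcm,
    neighbourLattice_eq_rotatedCopy hm0 hq₀pos.ne' hvq₀]
  have hmodd : Odd (m : ℤ) := by exact_mod_cast hm
  suffices ∃ R, neighbourLattice v₀ q₀ m = rotatedCopy R (integerLattice 3) by
    obtain ⟨R, hR⟩ := this
    exact ⟨_, by rw [hR, ← rotatedCopy_trans]⟩
  rcases Int.even_or_odd q₀ with he | ho
  · obtain ⟨k, hk⟩ := he
    rw [← two_mul] at hk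
    have hkodd : Odd k := by
      rw [← Int.not_even_iff_odd]
      rintro ⟨l, hl⟩
      exact not_four_dvd_dotProduct_self hw₀ ⟨m * l, by rw [hvq₀, hk, hl]; ring⟩
    rw [hk, neighbourLattice_two_mul hmodd hkodd]
    lift k to ℕ using by lia
    exact ih k (by lia) (by exact_mod_cast hkodd) v₀ _ (by rw [hvq₀, hk]; ring)
      ⟨w₀, by simp [hw₀]⟩
  · lift q₀ to ℕ using hq₀pos.le
    exact ih q₀ (by lia) (by exact_mod_cast ho) v₀ _ (by rw [hvq₀]; ring) ⟨w₀, by simp [hw₀]⟩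

/-! ### From primitive isotropic vectors to CSLs -/

theorem ofIntVec_mem_neighbourLattice {v : Fin 3 → ℤ} {m q : ℤ} (hm : Odd m)
    (hv : v ⬝ᵥ v = m * q) (hprim : ∃ w : Fin 3 → ℤ, m ∣ w ⬝ᵥ v - 1) (x : Fin 3 → ℤ) :
    ofIntVec x ∈ neighbourLattice v m q ↔ m ∣ v ⬝ᵥ x := by
  have hm0 : m ≠ 0 := by rintro rfl; simp at hm
  have hm' : (m : ℝ) ≠ 0 := mod_cast hm0
  constructor
  · rintro ⟨x', j, hx, c, hc⟩
    have hx : m • x = m • x' + j • v := by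
      apply ofIntVec_injective
      rw [map_add, ofIntVec_zsmul, ofIntVec_zsmul, ofIntVec_zsmul, hx, smul_add, smul_smul,
        mul_div_cancel₀ _ hm']
    obtain ⟨w, t, ht⟩ := hprim
    -- Pairing `m x = m x' + j v` with `w`, where `w ⬝ᵥ v ≡ 1`, isolates `j` modulo `m`.
    obtain ⟨k, rfl⟩ : m ∣ j := by
      have := congrArg (w ⬝ᵥ ·) hx
      simp only [dotProduct_add, dotProduct_smul, smul_eq_mul] at this
      exact ⟨w ⬝ᵥ x - w ⬝ᵥ x' - j * t, by linear_combination -this - j * ht⟩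
    have hx : v ⬝ᵥ x = v ⬝ᵥ x' + k * (m * q) := by
      apply mul_left_cancel₀ hm0
      have := congrArg (v ⬝ᵥ ·) hx
      simp only [dotProduct_add, dotProduct_smul, smul_eq_mul] at this
      rw [this, hv]; ring
    have h2 : IsCoprime m 2 := by
      obtain ⟨l, hl⟩ := hm
      exact ⟨1, -l, by rw [hl]; ring⟩
    exact h2.dvd_of_dvd_mul_left ⟨c + k * q, by linear_combination 2 * hx + hc⟩
  · rintro ⟨c, hc⟩
    exact ⟨x, 0, by simp, 2 * c, by rw [hc]; ring⟩

theorem smul_mem_integerLattice_of_mem_neighbourLattice {v : Fin 3 → ℤ} {m q : ℤ} (hm : m ≠ 0)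
    {y : EuclideanSpace ℝ (Fin 3)} (hy : y ∈ neighbourLattice v m q) :
    m • y ∈ integerLattice 3 := by
  obtain ⟨x, j, rfl, -⟩ := hy
  refine mem_integerLattice.2 ⟨m • x + j • v, ?_⟩
  have hm' : (m : ℝ) ≠ 0 := mod_cast hm
  rw [map_add, ofIntVec_zsmul, ofIntVec_zsmul, ← Int.cast_smul_eq_zsmul ℝ, smul_add, smul_smul,
    mul_div_cancel₀ _ hm']

/-- The quotient is a finitely generated torsion abelian group, hence finite. -/
theorem AddSubgroup.relIndex_ne_zero_of_zsmul_mem {G : Type*} [AddCommGroup G] {H K : AddSubgroup G}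
    [AddGroup.FG K] {m : ℤ} (hm : m ≠ 0) (h : ∀ y ∈ K, m • y ∈ H) : H.relIndex K ≠ 0 := by
  have : Finite (K ⧸ H.addSubgroupOf K) := by
    refine AddCommGroup.finite_of_fg_isAddTorsion _ fun a => ?_
    induction a using QuotientAddGroup.induction_on with
    | H y =>
      rw [isOfFinAddOrder_iff_zsmul_eq_zero]
      refine ⟨m, hm, ?_⟩
      rw [← QuotientAddGroup.mk_zsmul, QuotientAddGroup.eq_zero_iff, AddSubgroup.mem_addSubgroupOf]
      exact h y y.2
  exact AddSubgroup.index_ne_zero_iff_finite.2 this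

/-- The linear form on `ℤ³` with values in `ℤ/m` given by the coefficients `v`. -/
def dotProductHom {m : ℕ} (v : Fin 3 → ZMod m) : (Fin 3 → ℤ) →+ ZMod m where
  toFun x := v ⬝ᵥ fun i => (x i : ZMod m)
  map_zero' := by simp [dotProduct]
  map_add' x y := by simp only [dotProduct, Fin.sum_univ_three, Pi.add_apply]; push_cast; ring

theorem dotProductHom_apply {m : ℕ} (v : Fin 3 → ZMod m) (x : Fin 3 → ℤ) :
    dotProductHom v x = v ⬝ᵥ fun i => (x i : ZMod m) := rfl

/-- The sublattice of `ℤ³` of all vectors orthogonal to `v` modulo `m`. -/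
noncomputable def orthogonalSublattice {m : ℕ} (v : Fin 3 → ZMod m) :
    AddSubgroup (EuclideanSpace ℝ (Fin 3)) :=
  (dotProductHom v).ker.map ofIntVec

theorem ofIntVec_mem_orthogonalSublattice {m : ℕ} {v : Fin 3 → ZMod m} {x : Fin 3 → ℤ} :
    ofIntVec x ∈ orthogonalSublattice v ↔ v ⬝ᵥ (fun i => (x i : ZMod m)) = 0 := by
  rw [orthogonalSublattice, AddSubgroup.mem_map_iff_mem ofIntVec_injective]
  rfl

theorem orthogonalSublattice_le {m : ℕ} (v : Fin 3 → ZMod m) :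
    orthogonalSublattice v ≤ integerLattice 3 := by
  rw [integerLattice_three]
  rintro _ ⟨x, -, rfl⟩
  exact ⟨x, rfl⟩

/-- The primitive isotropic vectors of the quadratic form `x² + y² + z²` over a commutative ring. -/
def primitiveIsotropic (A : Type*) [CommRing A] : Set (Fin 3 → A) :=
  {v | v ⬝ᵥ v = 0 ∧ ∃ w, w ⬝ᵥ v = 1}

theorem relIndex_orthogonalSublattice {m : ℕ} {v w : Fin 3 → ZMod m} (hw : w ⬝ᵥ v = 1) :
    (orthogonalSublattice v).relIndex (integerLattice 3) = m := by
  rw [integerLattice_three, AddMonoidHom.range_eq_map, orthogonalSublattice,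
    AddSubgroup.relIndex_map_map_of_injective _ _ ofIntVec_injective, AddSubgroup.relIndex_top_right,
    AddSubgroup.index_ker, AddMonoidHom.range_eq_top.2, AddSubgroup.card_top, Nat.card_zmod]
  intro a
  obtain ⟨b, rfl⟩ := ZMod.intCast_surjective a
  choose x hx using fun i => ZMod.intCast_surjective (w i)
  refine ⟨b • x, ?_⟩
  have : (fun i => ((x i : ℤ) : ZMod m)) = w := funext hx
  rw [map_zsmul, dotProductHom_apply, this, dotProduct_comm, hw, zsmul_one]

theorem intCast_dotProduct {A : Type*} [CommRing A] (x y : Fin 3 → ℤ) :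
    ((x ⬝ᵥ y : ℤ) : A) = (fun i => ((x i : ℤ) : A)) ⬝ᵥ fun i => ((y i : ℤ) : A) := by
  simp [dotProduct]

theorem orthogonalSublattice_mem_cslsOfIndex {m : ℕ} (hm : Odd m) {v : Fin 3 → ZMod m}
    (hv : v ∈ primitiveIsotropic (ZMod m)) :
    orthogonalSublattice v ∈ cslsOfIndex (integerLattice 3) m := by
  obtain ⟨hiso, w, hw⟩ := hv
  choose v₁ hv₁ using fun i => ZMod.intCast_surjective (v i)
  choose w₁ hw₁ using fun i => ZMod.intCast_surjective (w i)
  have hv₁' : v = fun i => ((v₁ i : ℤ) : ZMod m) := (funext hv₁).symm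
  have hw₁' : w = fun i => ((w₁ i : ℤ) : ZMod m) := (funext hw₁).symm
  obtain ⟨q, hq⟩ : (m : ℤ) ∣ v₁ ⬝ᵥ v₁ := by
    rw [← ZMod.intCast_zmod_eq_zero_iff_dvd, intCast_dotProduct, ← hv₁', hiso]
  have hprim : (m : ℤ) ∣ w₁ ⬝ᵥ v₁ - 1 := by
    rw [← ZMod.intCast_zmod_eq_zero_iff_dvd, Int.cast_sub, intCast_dotProduct, ← hv₁', ← hw₁', hw]
    simp
  have hm0 : (m : ℤ) ≠ 0 := by have := hm.pos; lia
  obtain ⟨R, hR⟩ := exists_rotatedCopy_eq_neighbourLattice m hm v₁ q hq ⟨w₁, hprim⟩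
  have hinf : orthogonalSublattice v = integerLattice 3 ⊓ rotatedCopy R (integerLattice 3) := by
    ext y
    rw [← hR, AddSubgroup.mem_inf]
    have key : ∀ x, ofIntVec x ∈ orthogonalSublattice v ↔
        ofIntVec x ∈ neighbourLattice v₁ m q := fun x => by
      rw [ofIntVec_mem_orthogonalSublattice, ofIntVec_mem_neighbourLattice (by exact_mod_cast hm) hq
        ⟨w₁, hprim⟩, ← ZMod.intCast_zmod_eq_zero_iff_dvd, intCast_dotProduct, hv₁']
    constructor
    · intro hy
      have hy' := orthogonalSublattice_le v hy
      refine ⟨hy', ?_⟩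
      obtain ⟨x, rfl⟩ := mem_integerLattice.1 hy'
      exact (key x).1 hy
    · rintro ⟨hy, hy'⟩
      obtain ⟨x, rfl⟩ := mem_integerLattice.1 hy
      exact (key x).2 hy'
  have hidx := relIndex_orthogonalSublattice hw
  refine ⟨⟨R, ⟨?_, ?_⟩, hinf⟩, hidx⟩
  · rw [hinf, AddSubgroup.inf_relIndex_left] at hidx
    rw [hidx]; exact_mod_cast hm0
  · have : AddGroup.FG (rotatedCopy R (integerLattice 3)) := by
      rw [rotatedCopy, integerLattice_three, ← AddMonoidHom.range_comp]
      infer_instance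
    exact AddSubgroup.relIndex_ne_zero_of_zsmul_mem hm0 fun y hy =>
      smul_mem_integerLattice_of_mem_neighbourLattice hm0 (by rwa [hR])

/-! ### From coincidence isometries to primitive isotropic vectors -/

theorem exists_scaled_matrix {R : EuclideanSpace ℝ (Fin 3) ≃ₗᵢ[ℝ] EuclideanSpace ℝ (Fin 3)}
    (hR : IsCoincidenceIsometry (integerLattice 3) R) :
    ∃ n : ℕ, 0 < n ∧ ∃ M : Matrix (Fin 3) (Fin 3) ℤ,
      ∀ x, (n : ℝ) • R (ofIntVec x) = ofIntVec (M *ᵥ x) := by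
  -- The multiplier is the index of the intersection in `R ℤ³`, which annihilates the quotient.
  refine ⟨_, Nat.pos_of_ne_zero hR.2, ?_⟩
  set N := (integerLattice 3).relIndex (rotatedCopy R (integerLattice 3))
  have h : ∀ x : Fin 3 → ℤ, ∃ y, ofIntVec y = (N : ℝ) • R (ofIntVec x) := fun x => by
    have hx : R (ofIntVec x) ∈ rotatedCopy R (integerLattice 3) :=
      mem_rotatedCopy.2 (by simpa using mem_integerLattice.2 ⟨x, rfl⟩)
    have := AddSubgroup.nsmul_index_mem
      ((integerLattice 3).addSubgroupOf (rotatedCopy R (integerLattice 3))) ⟨_, hx⟩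
    rw [AddSubgroup.mem_addSubgroupOf, mem_integerLattice] at this
    obtain ⟨y, hy⟩ := this
    refine ⟨y, hy.trans ?_⟩
    rw [Nat.cast_smul_eq_nsmul]
    rfl
  choose g hg using h
  let G : (Fin 3 → ℤ) →+ (Fin 3 → ℤ) := AddMonoidHom.mk' g fun a b => by
    apply ofIntVec_injective
    rw [map_add, hg, hg, hg, map_add, map_add, smul_add]
  refine ⟨LinearMap.toMatrix' G.toIntLinearMap, fun x => ?_⟩
  rw [LinearMap.toMatrix'_mulVec]
  exact (hg x).symm

theorem transpose_mul_self_of_scaled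
    {R : EuclideanSpace ℝ (Fin 3) ≃ₗᵢ[ℝ] EuclideanSpace ℝ (Fin 3)} {n : ℕ}
    {M : Matrix (Fin 3) (Fin 3) ℤ} (h : ∀ x, (n : ℝ) • R (ofIntVec x) = ofIntVec (M *ᵥ x)) :
    Mᵀ * M = ((n : ℤ) ^ 2) • (1 : Matrix (Fin 3) (Fin 3) ℤ) := by
  have key : ∀ x y : Fin 3 → ℤ, (M *ᵥ x) ⬝ᵥ (M *ᵥ y) = (n : ℤ) ^ 2 * (x ⬝ᵥ y) := fun x y => by
    have : (((M *ᵥ x) ⬝ᵥ (M *ᵥ y) : ℤ) : ℝ) = (n : ℝ) ^ 2 * ((x ⬝ᵥ y : ℤ) : ℝ) := by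
      rw [← inner_ofIntVec, ← inner_ofIntVec, ← h, ← h, inner_smul_left, inner_smul_right,
        LinearIsometryEquiv.inner_map_map]
      simp; ring
    exact_mod_cast this
  ext i j
  have := key (Pi.single i 1) (Pi.single j 1)
  rw [Matrix.mulVec_single_one, Matrix.mulVec_single_one, single_one_dotProduct] at this
  rw [Matrix.smul_apply, Matrix.one_apply, smul_eq_mul]
  exact this.trans (by rw [Pi.single_apply])

theorem smul_adjugate_of_scaled {n : ℤ} {M : Matrix (Fin 3) (Fin 3) ℤ}
    (h : Mᵀ * M = (n ^ 2) • (1 : Matrix (Fin 3) (Fin 3) ℤ)) : n ^ 2 • M.adjugate = M.det • Mᵀ := by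
  have := congrArg (· * M.adjugate) h
  simp only [Matrix.mul_assoc, Matrix.mul_adjugate, Matrix.smul_mul, Matrix.one_mul,
    Matrix.mul_smul, Matrix.mul_one] at this
  exact this.symm

theorem det_of_scaled {n : ℤ} {M : Matrix (Fin 3) (Fin 3) ℤ}
    (h : Mᵀ * M = (n ^ 2) • (1 : Matrix (Fin 3) (Fin 3) ℤ)) : M.det = n ^ 3 ∨ M.det = -n ^ 3 := by
  have := congrArg Matrix.det h
  rw [Matrix.det_mul, Matrix.det_transpose, Matrix.det_smul, Matrix.det_one, Fintype.card_fin] at this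
  exact sq_eq_sq_iff_eq_or_eq_neg.1 (by linear_combination this)

theorem mul_transpose_self_of_scaled {n : ℤ} (hn : n ≠ 0) {M : Matrix (Fin 3) (Fin 3) ℤ}
    (h : Mᵀ * M = (n ^ 2) • (1 : Matrix (Fin 3) (Fin 3) ℤ)) :
    M * Mᵀ = (n ^ 2) • (1 : Matrix (Fin 3) (Fin 3) ℤ) := by
  have hdet : M.det ≠ 0 := by
    rcases det_of_scaled h with h | h <;> rw [h] <;> simpa using hn
  have := congrArg (M * ·) (smul_adjugate_of_scaled h)
  simp only [Matrix.mul_smul, Matrix.mul_adjugate] at this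
  rw [smul_comm] at this
  exact (smul_right_injective _ hdet this).symm

/-- As `det M = ± n³`, cancelling `n²` in `n² adj M = det M • Mᵀ` gives `adj M = ± n Mᵀ`. Hence the
2×2 minors of `M` vanish modulo `n`. -/
theorem dvd_adjugate_of_scaled {n : ℤ} (hn : n ≠ 0) {M : Matrix (Fin 3) (Fin 3) ℤ}
    (h : Mᵀ * M = (n ^ 2) • (1 : Matrix (Fin 3) (Fin 3) ℤ)) (i j : Fin 3) :
    n ∣ M.adjugate i j := by
  have h1 := congrFun (congrFun (smul_adjugate_of_scaled h) i) j
  simp only [Matrix.smul_apply, smul_eq_mul, Matrix.transpose_apply] at h1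
  have hn2 : n ^ 2 ≠ 0 := pow_ne_zero 2 hn
  rcases det_of_scaled h with hd | hd <;> rw [hd] at h1
  · exact ⟨M j i, mul_left_cancel₀ hn2 (by linear_combination h1)⟩
  · exact ⟨-M j i, mul_left_cancel₀ hn2 (by linear_combination h1)⟩

theorem mul_eq_mul_of_adjugate_eq_zero {A : Type*} [CommRing A] {M : Matrix (Fin 3) (Fin 3) A}
    (h : M.adjugate = 0) (i j k l : Fin 3) : M i j * M k l = M i l * M k j := by
  rw [Matrix.adjugate_fin_three] at h
  have e := fun a b => congrFun (congrFun h a) b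
  have e00 := e 0 0
  have e01 := e 0 1
  have e02 := e 0 2
  have e10 := e 1 0
  have e11 := e 1 1
  have e12 := e 1 2
  have e20 := e 2 0
  have e21 := e 2 1
  have e22 := e 2 2
  simp at e00 e01 e02 e10 e11 e12 e20 e21 e22
  clear e h
  fin_cases i <;> fin_cases j <;> fin_cases k <;> fin_cases l <;> simp <;> grind

theorem exists_int_forall_prime_dvd_sub (n : ℕ) (a : ℕ → ℕ) :
    ∃ t : ℤ, ∀ p, p.Prime → p ∣ n → n ≠ 0 → (p : ℤ) ∣ t - a p := by
  obtain ⟨k, hk⟩ := Nat.chineseRemainderOfFinset a id n.primeFactors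
    (fun p hp => (Nat.prime_of_mem_primeFactors hp).ne_zero)
    (fun p hp q hq hpq => (Nat.coprime_primes (Nat.prime_of_mem_primeFactors hp)
      (Nat.prime_of_mem_primeFactors hq)).2 hpq)
  refine ⟨k, fun p hp hpn hn => ?_⟩
  exact (Nat.modEq_iff_dvd.1 (hk p (Nat.mem_primeFactors.2 ⟨hp, hpn, hn⟩)).symm)

/-- For each prime `p` dividing `n`, some column of `M` is nonzero modulo `p`; the Chinese remainder
theorem provides `t` congruent to the corresponding unit vector modulo every such `p`. -/
theorem exists_mulVec_not_dvd {n : ℕ} (hn : n ≠ 0) {M : Matrix (Fin 3) (Fin 3) ℤ}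
    (h : ∀ p : ℕ, p.Prime → p ∣ n → ∃ i j, ¬ (p : ℤ) ∣ M i j) :
    ∃ t : Fin 3 → ℤ, ∀ p : ℕ, p.Prime → p ∣ n → ∃ i, ¬ (p : ℤ) ∣ (M *ᵥ t) i := by
  have h' : ∀ p : ℕ, ∃ j, p.Prime → p ∣ n → ∃ i, ¬ (p : ℤ) ∣ M i j := fun p => by
    by_cases hp : p.Prime ∧ p ∣ n
    · obtain ⟨i, j, hij⟩ := h p hp.1 hp.2
      exact ⟨j, fun _ _ => ⟨i, hij⟩⟩
    · exact ⟨0, fun h1 h2 => absurd ⟨h1, h2⟩ hp⟩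
  choose J hJ using h'
  choose t ht using fun k => exists_int_forall_prime_dvd_sub n fun p => if J p = k then 1 else 0
  refine ⟨t, fun p hp hpn => ?_⟩
  obtain ⟨i, hi⟩ := hJ p hp hpn
  refine ⟨i, fun hdvd => hi ?_⟩
  have key : (p : ℤ) ∣ (M *ᵥ t) i - M i (J p) := by
    have : (M *ᵥ t) i - M i (J p) = ∑ k, M i k * (t k - ((if J p = k then 1 else 0 : ℕ) : ℤ)) := by
      simp [Matrix.mulVec, dotProduct, mul_sub, Finset.sum_sub_distrib]
    rw [this]
    exact Finset.dvd_sum fun k _ => (ht k p hp hpn hn).mul_left _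
  simpa using dvd_sub hdvd key

theorem exists_dotProduct_sub_one_dvd {n : ℕ} {v : Fin 3 → ℤ}
    (h : ∀ p : ℕ, p.Prime → p ∣ n → ∃ i, ¬ (p : ℤ) ∣ v i) :
    ∃ w : Fin 3 → ℤ, (n : ℤ) ∣ w ⬝ᵥ v - 1 := by
  obtain ⟨g, hg⟩ := (IsPrincipalIdealRing.principal
    (Ideal.span (Set.range v) ⊔ Ideal.span {(n : ℤ)})).principal
  rw [Ideal.submodule_span_eq] at hg
  have hgn : g ∣ n := Ideal.mem_span_singleton.1
    (hg ▸ Ideal.mem_sup_right (Ideal.mem_span_singleton_self _))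
  have hgv : ∀ i, g ∣ v i := fun i => Ideal.mem_span_singleton.1
    (hg ▸ Ideal.mem_sup_left (Ideal.subset_span ⟨i, rfl⟩))
  have hunit : g.natAbs = 1 := by
    by_contra hne
    obtain ⟨p, hp, hpg⟩ := Nat.exists_prime_and_dvd hne
    have hpg' : (p : ℤ) ∣ g := Int.natCast_dvd.2 hpg
    obtain ⟨i, hi⟩ := h p hp (by exact_mod_cast hpg'.trans hgn)
    exact hi (hpg'.trans (hgv i))
  have htop : (1 : ℤ) ∈ Ideal.span (Set.range v) ⊔ Ideal.span {(n : ℤ)} := by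
    rw [hg, Ideal.mem_span_singleton]
    exact (Int.isUnit_iff_natAbs_eq.2 hunit).dvd
  obtain ⟨a, ha, b, hb, hab⟩ := Submodule.mem_sup.1 htop
  obtain ⟨w, rfl⟩ := Ideal.mem_span_range_iff_exists_fun.1 ha
  obtain ⟨c, rfl⟩ := Ideal.mem_span_singleton.1 hb
  exact ⟨w, -c, by rw [dotProduct]; linear_combination hab⟩

/-- Vanishing minors and a unimodular `v = M *ᵥ t` factor `M` as the column `v` times the row `wᵀ
M`, so `Mᵀ x` is `v ⬝ᵥ x` times that row. -/
theorem transpose_mulVec_eq_zero_iff {A : Type*} [CommRing A] {M : Matrix (Fin 3) (Fin 3) A}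
    (hM : M.adjugate = 0) {t w : Fin 3 → A} (hw : w ⬝ᵥ (M *ᵥ t) = 1) (x : Fin 3 → A) :
    Mᵀ *ᵥ x = 0 ↔ (M *ᵥ t) ⬝ᵥ x = 0 := by
  constructor
  · intro h
    rw [dotProduct_comm, Matrix.dotProduct_mulVec, ← Matrix.mulVec_transpose, h, zero_dotProduct]
  · intro h
    have hcol : ∀ i j, M i j = (M *ᵥ t) i * ∑ k, w k * M k j := fun i j => by
      have e : ∀ k, (M *ᵥ t) i * M k j = (M *ᵥ t) k * M i j := fun k => by
        simp only [Matrix.mulVec, dotProduct, Finset.sum_mul]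
        refine Finset.sum_congr rfl fun l _ => ?_
        have := mul_eq_mul_of_adjugate_eq_zero hM i j k l
        linear_combination (-t l) * this
      rw [Finset.mul_sum]
      calc M i j = (w ⬝ᵥ (M *ᵥ t)) * M i j := by rw [hw, one_mul]
        _ = ∑ k, w k * (M *ᵥ t) k * M i j := by rw [dotProduct, Finset.sum_mul]
        _ = _ := Finset.sum_congr rfl fun k _ => by linear_combination -w k * e k
    ext j
    calc (Mᵀ *ᵥ x) j = ∑ i, M i j * x i := rfl
      _ = ∑ i, (∑ k, w k * M k j) * ((M *ᵥ t) i * x i) :=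
        Finset.sum_congr rfl fun i _ => by rw [hcol i j]; ring
      _ = (∑ k, w k * M k j) * ((M *ᵥ t) ⬝ᵥ x) := by rw [dotProduct, Finset.mul_sum]
      _ = 0 := by rw [h, mul_zero]

theorem exists_orthogonalSublattice_eq {R : EuclideanSpace ℝ (Fin 3) ≃ₗᵢ[ℝ] EuclideanSpace ℝ (Fin 3)}
    (hR : IsCoincidenceIsometry (integerLattice 3) R) :
    ∃ n : ℕ, Odd n ∧ ∃ v ∈ primitiveIsotropic (ZMod n),
      integerLattice 3 ⊓ rotatedCopy R (integerLattice 3) = orthogonalSublattice v := by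
  classical
  have hex := exists_scaled_matrix hR
  obtain ⟨hnpos, M, hM⟩ := Nat.find_spec hex
  have hmin : ∀ k : ℕ, k < Nat.find hex → 0 < k → ∀ M' : Matrix (Fin 3) (Fin 3) ℤ,
      ¬ ∀ x, (k : ℝ) • R (ofIntVec x) = ofIntVec (M' *ᵥ x) :=
    fun k hk hk0 M' h' => Nat.find_min hex hk ⟨hk0, M', h'⟩
  generalize Nat.find hex = n at *
  clear hex
  have hn0 : (n : ℤ) ≠ 0 := by lia
  -- Otherwise `(n / p) R` would already be integral, against minimality of `n`.
  have hprim : ∀ p : ℕ, p.Prime → p ∣ n → ∃ i j, ¬ (p : ℤ) ∣ M i j := by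
    rintro p hp ⟨k, rfl⟩
    by_contra! hall
    choose M' hM' using hall
    have hk : 0 < k := pos_of_mul_pos_right hnpos (Nat.zero_le _)
    refine hmin k (by nlinarith [hp.two_le]) hk (Matrix.of M') fun x => ?_
    have hMM : M = (p : ℤ) • Matrix.of M' := by ext i j; simp [hM']
    have := hM x
    have hp0 : (p : ℝ) ≠ 0 := mod_cast hp.ne_zero
    rw [hMM, Matrix.smul_mulVec, ofIntVec_zsmul] at this
    push_cast at this
    rw [mul_smul] at this
    exact smul_right_injective _ hp0 this
  have hMM := transpose_mul_self_of_scaled hM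
  -- Each column of `M` has square norm `n²`; for even `n` this is divisible by 4, making all
  -- entries even.
  have hodd : Odd n := by
    rw [← Nat.not_even_iff_odd]
    intro he
    obtain ⟨k, hk⟩ := he
    obtain ⟨i, j, hij⟩ := hprim 2 Nat.prime_two ⟨k, by lia⟩
    refine hij (two_dvd_of_four_dvd_dotProduct_self (v := fun i => M i j) ⟨k ^ 2, ?_⟩ i)
    have := congrFun (congrFun hMM j) j
    simp only [Matrix.smul_apply, Matrix.one_apply_eq] at this
    refine this.trans ?_
    rw [hk]; push_cast; simp; ring
  obtain ⟨t, ht⟩ := exists_mulVec_not_dvd hnpos.ne' hprim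
  obtain ⟨w, hw⟩ := exists_dotProduct_sub_one_dvd ht
  let φ := Int.castRingHom (ZMod n)
  have hvec : ∀ (B : Matrix (Fin 3) (Fin 3) ℤ) (x : Fin 3 → ℤ),
      (fun i => (((B *ᵥ x) i : ℤ) : ZMod n)) = B.map φ *ᵥ fun i => (x i : ZMod n) := fun B x => by
    ext i
    simp [Matrix.mulVec, dotProduct, φ]
  have hadj : (M.map φ).adjugate = 0 := by
    have := RingHom.map_adjugate φ M
    rw [RingHom.mapMatrix_apply, RingHom.mapMatrix_apply] at this
    rw [← this]
    ext i j
    exact (ZMod.intCast_zmod_eq_zero_iff_dvd _ n).2 (dvd_adjugate_of_scaled hn0 hMM i j)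
  have hw' : (fun i => (w i : ZMod n)) ⬝ᵥ (M.map φ *ᵥ fun i => (t i : ZMod n)) = 1 := by
    rw [← hvec, ← intCast_dotProduct, ← sub_eq_zero, ← Int.cast_one, ← Int.cast_sub,
      ZMod.intCast_zmod_eq_zero_iff_dvd]
    exact hw
  have hiso : (n : ℤ) ∣ (M *ᵥ t) ⬝ᵥ (M *ᵥ t) := by
    rw [Matrix.dotProduct_mulVec, ← Matrix.mulVec_transpose, Matrix.mulVec_mulVec, hMM,
      Matrix.smul_mulVec, smul_dotProduct, sq, smul_eq_mul, mul_assoc]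
    exact dvd_mul_right _ _
  have hMt := mul_transpose_self_of_scaled hn0 hMM
  have hsymm : ∀ x, (n : ℝ) • R.symm (ofIntVec x) = ofIntVec (Mᵀ *ᵥ x) := fun x => by
    have hn' : (n : ℝ) ≠ 0 := mod_cast hn0
    apply R.injective
    apply smul_right_injective _ hn'
    simp only
    rw [hM, map_smul, R.apply_symm_apply, Matrix.mulVec_mulVec, hMt, Matrix.smul_mulVec,
      ofIntVec_zsmul, Matrix.one_mulVec, smul_smul]
    push_cast; rw [sq]
  refine ⟨n, hodd, fun i => ((M *ᵥ t) i : ZMod n), ⟨?_, _, by rw [hvec]; exact hw'⟩, ?_⟩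
  · rw [← intCast_dotProduct, ZMod.intCast_zmod_eq_zero_iff_dvd]
    exact hiso
  have key : ∀ x, ofIntVec x ∈ rotatedCopy R (integerLattice 3) ↔
      ofIntVec x ∈ orthogonalSublattice fun i => ((M *ᵥ t) i : ZMod n) := fun x => by
    rw [ofIntVec_mem_orthogonalSublattice, hvec, ← transpose_mulVec_eq_zero_iff hadj hw',
      mem_rotatedCopy, mem_integerLattice, ← Matrix.transpose_map, ← hvec]
    have hn' : (n : ℝ) ≠ 0 := mod_cast hn0
    constructor
    · rintro ⟨y, hy⟩
      have : Mᵀ *ᵥ x = (n : ℤ) • y := by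
        apply ofIntVec_injective
        rw [← hsymm, ofIntVec_zsmul, hy]; rfl
      rw [this]
      ext i
      simp
    · intro h
      have : ∀ i, (n : ℤ) ∣ (Mᵀ *ᵥ x) i := fun i =>
        (ZMod.intCast_zmod_eq_zero_iff_dvd _ n).1 (congrFun h i)
      choose y hy using this
      refine ⟨y, smul_right_injective _ hn' ?_⟩
      simp only
      rw [hsymm, show Mᵀ *ᵥ x = (n : ℤ) • y from funext hy, ofIntVec_zsmul]; rfl
  ext y
  constructor
  · rintro ⟨hy, hy'⟩
    obtain ⟨x, rfl⟩ := mem_integerLattice.1 hy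
    exact (key x).1 hy'
  · intro hy
    have hy' := orthogonalSublattice_le _ hy
    obtain ⟨x, rfl⟩ := mem_integerLattice.1 hy'
    exact ⟨hy', (key x).2 hy⟩

theorem cslsOfIndex_eq_image {m : ℕ} (hm : Odd m) :
    cslsOfIndex (integerLattice 3) m = orthogonalSublattice '' primitiveIsotropic (ZMod m) := by
  apply Set.Subset.antisymm
  · rintro _ ⟨⟨R, hR, rfl⟩, hidx⟩
    obtain ⟨n, -, v, hv, heq⟩ := exists_orthogonalSublattice_eq hR
    rw [heq, relIndex_orthogonalSublattice hv.2.choose_spec] at hidx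
    subst hidx
    exact ⟨v, hv, heq.symm⟩
  · rintro _ ⟨v, hv, rfl⟩
    exact orthogonalSublattice_mem_cslsOfIndex hm hv

theorem cslsOfIndex_eq_empty {m : ℕ} (hm : ¬ Odd m) : cslsOfIndex (integerLattice 3) m = ∅ := by
  rw [Set.eq_empty_iff_forall_notMem]
  rintro _ ⟨⟨R, hR, rfl⟩, hidx⟩
  obtain ⟨n, hn, v, hv, heq⟩ := exists_orthogonalSublattice_eq hR
  rw [heq, relIndex_orthogonalSublattice hv.2.choose_spec] at hidx
  exact hm (hidx ▸ hn)

/-! ### Counting primitive isotropic vectors modulo `m` -/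

/-- Dirichlet's theorem gives a prime `p ≡ 2m² - 1` modulo `4m`. Then `p ≡ 1` modulo 4, so `p` is a
sum of two squares, and `p ≡ -1` modulo `m`. -/
theorem exists_sq_add_sq_eq_neg_one {m : ℕ} (hm : Odd m) :
    ∃ a b : ZMod m, a ^ 2 + b ^ 2 = -1 := by
  obtain ⟨p, -, hp, hmod⟩ := Nat.forall_exists_prime_gt_and_zmodEq 0 (q := 4 * m)
    (a := 2 * (m : ℤ) ^ 2 - 1) (by have := hm.pos; lia)
    ⟨-(2 * (m : ℤ) ^ 2 + 1), (m : ℤ) ^ 3, by push_cast; ring⟩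
  obtain ⟨c, hc⟩ := hmod.symm.dvd
  push_cast at hc
  obtain ⟨l, hl⟩ := hm
  have hp4 : p % 4 ≠ 3 := by
    have : (p : ℤ) = 4 * (2 * l ^ 2 + 2 * l + m * c) + 1 := by
      have hl' : (m : ℤ) = 2 * l + 1 := by exact_mod_cast hl
      linear_combination hc + (2 * (m : ℤ) + 2 * (2 * l + 1)) * hl'
    lia
  have : Fact p.Prime := ⟨hp⟩
  obtain ⟨a, b, hab⟩ := Nat.Prime.sq_add_sq hp4
  refine ⟨a, b, ?_⟩
  have h1 : ((a : ZMod m)) ^ 2 + (b : ZMod m) ^ 2 = p := by exact_mod_cast congrArg _ hab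
  have h2 := congrArg (Int.cast : ℤ → ZMod m) hc
  push_cast at h2
  rw [ZMod.natCast_self] at h2
  rw [h1]
  linear_combination h2

theorem eq_smul_of_orthogonalSublattice_le {m : ℕ} {v w a : Fin 3 → ZMod m}
    (ha : a ⬝ᵥ v = 1) (h : orthogonalSublattice v ≤ orthogonalSublattice w) :
    w = (w ⬝ᵥ a) • v := by
  have key : ∀ y : Fin 3 → ZMod m, w ⬝ᵥ y = (w ⬝ᵥ a) * (v ⬝ᵥ y) := fun y => by
    -- Projecting `y` along `a` into the kernel of `v`, where `w` vanishes too, determines `w ⬝ᵥ y`.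
    have hx : v ⬝ᵥ (y - (v ⬝ᵥ y) • a) = 0 := by
      rw [dotProduct_sub, dotProduct_smul, dotProduct_comm v a, ha]; simp
    choose x hx' using fun i => ZMod.intCast_surjective ((y - (v ⬝ᵥ y) • a) i)
    have hx'' : (fun i => ((x i : ℤ) : ZMod m)) = y - (v ⬝ᵥ y) • a := funext hx'
    have := ofIntVec_mem_orthogonalSublattice.1
      (h (ofIntVec_mem_orthogonalSublattice.2 (by rw [hx'', hx]) : ofIntVec x ∈ _))
    rw [hx'', dotProduct_sub, dotProduct_smul, smul_eq_mul] at this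
    linear_combination this
  ext i
  have := key (Pi.single i 1)
  rwa [dotProduct_single_one, dotProduct_single_one] at this

theorem orthogonalSublattice_eq_iff {m : ℕ} {v w : Fin 3 → ZMod m}
    (hv : ∃ a, a ⬝ᵥ v = 1) (hw : ∃ a, a ⬝ᵥ w = 1) :
    orthogonalSublattice w = orthogonalSublattice v ↔ ∃ u : (ZMod m)ˣ, u • v = w := by
  constructor
  · intro h
    obtain ⟨a, ha⟩ := hv
    obtain ⟨b, hb⟩ := hw
    have h1 := eq_smul_of_orthogonalSublattice_le ha h.ge
    have h2 := eq_smul_of_orthogonalSublattice_le hb h.le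
    have h3 : (w ⬝ᵥ a) * (v ⬝ᵥ b) = 1 := by
      have := congrArg (a ⬝ᵥ ·) h2
      simp only [dotProduct_smul, smul_eq_mul, ha] at this
      rw [dotProduct_comm w a, mul_comm, ← this]
    exact ⟨⟨_, _, h3, by rw [mul_comm, h3]⟩, h1.symm⟩
  · rintro ⟨u, rfl⟩
    ext y
    rw [orthogonalSublattice, orthogonalSublattice]
    have : (dotProductHom (u • v)).ker = (dotProductHom v).ker := by
      ext x
      simp [AddMonoidHom.mem_ker, dotProductHom_apply, smul_eq_zero_iff_eq]
    rw [this]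

theorem finite_primitiveIsotropic {m : ℕ} (hm : m ≠ 0) : (primitiveIsotropic (ZMod m)).Finite := by
  have : NeZero m := ⟨hm⟩
  exact Set.toFinite _

/-- The fibres of `orthogonalSublattice` on primitive isotropic vectors are unit orbits, and the
action is free because the vectors are primitive. -/
theorem cubicCSLCount_mul_totient {m : ℕ} (hm : Odd m) :
    cubicCSLCount m * m.totient = (primitiveIsotropic (ZMod m)).ncard := by
  classical
  have hm0 : m ≠ 0 := hm.pos.ne'
  have : NeZero m := ⟨hm0⟩
  set s := (finite_primitiveIsotropic hm0).toFinset with hs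
  have hmem : ∀ v, v ∈ s ↔ v ∈ primitiveIsotropic (ZMod m) := fun v => by simp [hs]
  have hsc : (s : Set (Fin 3 → ZMod m)) = primitiveIsotropic (ZMod m) := by ext; simp [hmem]
  rw [cubicCSLCount, cslsOfIndex_eq_image hm, ← hsc, ← Finset.coe_image, Set.ncard_coe_finset,
    Set.ncard_coe_finset, Finset.card_eq_sum_card_image orthogonalSublattice s,
    ← smul_eq_mul, ← Finset.sum_const]
  refine Finset.sum_congr rfl fun Λ hΛ => ?_
  obtain ⟨v, hv, rfl⟩ := Finset.mem_image.1 hΛ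
  obtain ⟨hiso, a, ha⟩ := (hmem v).1 hv
  have hfib : s.filter (fun w => orthogonalSublattice w = orthogonalSublattice v) =
      Finset.univ.image fun u : (ZMod m)ˣ => u • v := by
    ext w
    rw [Finset.mem_filter, hmem, Finset.mem_image]
    simp only [Finset.mem_univ, true_and]
    constructor
    · rintro ⟨⟨-, hw⟩, h⟩
      exact (orthogonalSublattice_eq_iff ⟨a, ha⟩ hw).1 h
    · rintro ⟨u, rfl⟩
      have hw : ∃ b, b ⬝ᵥ (u • v) = 1 := ⟨u⁻¹ • a, by simp [ha, smul_smul]⟩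
      refine ⟨⟨by simp [hiso], hw⟩, (orthogonalSublattice_eq_iff ⟨a, ha⟩ hw).2 ⟨u, rfl⟩⟩
  rw [hfib, Finset.card_image_of_injective, Finset.card_univ, ZMod.card_units_eq_totient]
  intro u u' h
  have := congrArg (a ⬝ᵥ ·) h
  simp only [dotProduct_smul, ha, Units.smul_def, smul_eq_mul, mul_one] at this
  exact Units.ext this

theorem ncard_primitiveIsotropic_congr {A B : Type*} [CommRing A] [CommRing B] (e : A ≃+* B) :
    (primitiveIsotropic A).ncard = (primitiveIsotropic B).ncard := by
  have hdot : ∀ (x y : Fin 3 → A), (fun i => e (x i)) ⬝ᵥ (fun i => e (y i)) = e (x ⬝ᵥ y) :=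
    fun x y => by simp [dotProduct]
  refine Nat.card_congr (Equiv.subtypeEquiv (Equiv.piCongrRight fun _ => e.toEquiv) fun v => ?_)
  change _ ↔ (fun i => e (v i)) ∈ primitiveIsotropic B
  refine and_congr ?_ ⟨fun ⟨w, hw⟩ => ⟨fun i => e (w i), by rw [hdot, hw, map_one]⟩,
    fun ⟨w, hw⟩ => ⟨fun i => e.symm (w i), ?_⟩⟩
  · rw [hdot, map_eq_zero_iff e e.injective]
  · apply e.injective
    rw [← hdot]; simpa using hw

theorem ncard_primitiveIsotropic_prod (A B : Type*) [CommRing A] [CommRing B] :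
    (primitiveIsotropic (A × B)).ncard =
      (primitiveIsotropic A).ncard * (primitiveIsotropic B).ncard := by
  have hdot : ∀ (x y : Fin 3 → A × B), x ⬝ᵥ y =
      ((fun i => (x i).1) ⬝ᵥ (fun i => (y i).1), (fun i => (x i).2) ⬝ᵥ (fun i => (y i).2)) :=
    fun x y => Prod.ext (by simp [dotProduct, Prod.fst_sum]) (by simp [dotProduct, Prod.snd_sum])
  simp only [← Nat.card_coe_set_eq]
  rw [← Nat.card_prod]
  refine Nat.card_congr
    { toFun := fun v => (⟨fun i => (v.1 i).1, ?_⟩, ⟨fun i => (v.1 i).2, ?_⟩)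
      invFun := fun p => ⟨fun i => (p.1.1 i, p.2.1 i), ?_⟩
      left_inv := fun v => rfl
      right_inv := fun v => rfl }
  · obtain ⟨v, h, w, hw⟩ := v
    rw [hdot] at h hw
    exact ⟨congrArg Prod.fst h, fun i => (w i).1, congrArg Prod.fst hw⟩
  · obtain ⟨v, h, w, hw⟩ := v
    rw [hdot] at h hw
    exact ⟨congrArg Prod.snd h, fun i => (w i).2, congrArg Prod.snd hw⟩
  · obtain ⟨⟨v, h, w, hw⟩, ⟨v', h', w', hw'⟩⟩ := p
    exact ⟨by rw [hdot]; exact Prod.ext h h', fun i => (w i, w' i),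
      by rw [hdot]; exact Prod.ext hw hw'⟩

theorem cubicCSLCount_eq_zero {m : ℕ} (hm : ¬ Odd m) : cubicCSLCount m = 0 := by
  rw [cubicCSLCount, cslsOfIndex_eq_empty hm, Set.ncard_empty]

theorem cubicCSLCount_mul {m n : ℕ} (h : m.Coprime n) :
    cubicCSLCount (m * n) = cubicCSLCount m * cubicCSLCount n := by
  by_cases hm : Odd m
  swap
  · rw [cubicCSLCount_eq_zero hm, cubicCSLCount_eq_zero (by simp [Nat.odd_mul, hm]), zero_mul]
  by_cases hn : Odd n
  swap
  · rw [cubicCSLCount_eq_zero hn, cubicCSLCount_eq_zero (by simp [Nat.odd_mul, hn]), mul_zero]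
  have hmn : 0 < (m * n).totient := Nat.totient_pos.2 (Nat.mul_pos hm.pos hn.pos)
  apply Nat.eq_of_mul_eq_mul_right hmn
  rw [cubicCSLCount_mul_totient (hm.mul hn),
    ncard_primitiveIsotropic_congr (ZMod.chineseRemainder h), ncard_primitiveIsotropic_prod,
    ← cubicCSLCount_mul_totient hm, ← cubicCSLCount_mul_totient hn, Nat.totient_mul h]
  ring

/-! ### The isotropic cone over a local ring and values at prime powers -/

/-- The vector with coordinates `2x = Z - (aX + bY)`, `2y = Z + (aX + bY)`, `2z = bX - aY` up to a
factor `2`; if `a² + b² = -1`, then it is isotropic when `x * y = z²`. -/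
def conicVector {A : Type*} [CommRing A] (a b x y z : A) : Fin 3 → A :=
  ![-(a * (y - x) + b * (2 * z)), -(b * (y - x) - a * (2 * z)), x + y]

theorem conicVector_mem_primitiveIsotropic {A : Type*} [CommRing A] {a b x y z : A}
    (hab : a ^ 2 + b ^ 2 = -1) (h2 : IsUnit (2 : A)) (hxy : x * y = z ^ 2)
    (hu : IsUnit x ∨ IsUnit y) : conicVector a b x y z ∈ primitiveIsotropic A := by
  obtain ⟨h, hh⟩ := h2.exists_right_inv
  refine ⟨?_, ?_⟩
  · simp only [dotProduct, Fin.sum_univ_three, conicVector, Matrix.cons_val]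
    linear_combination ((y - x) ^ 2 + 4 * z ^ 2) * hab + 4 * hxy
  · rcases hu with hu | hu
    · obtain ⟨c, hc⟩ := hu.exists_right_inv
      refine ⟨(h * c) • ![-a, -b, 1], ?_⟩
      simp only [dotProduct, Fin.sum_univ_three, conicVector, Matrix.cons_val, Pi.smul_apply,
        smul_eq_mul]
      linear_combination (h * c * (y - x)) * hab + 2 * h * hc + hh
    · obtain ⟨c, hc⟩ := hu.exists_right_inv
      refine ⟨(h * c) • ![a, b, 1], ?_⟩
      simp only [dotProduct, Fin.sum_univ_three, conicVector, Matrix.cons_val, Pi.smul_apply,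
        smul_eq_mul]
      linear_combination (-h * c * (y - x)) * hab + 2 * h * hc + hh

theorem conicVector_injective {A : Type*} [CommRing A] {a b x y z x' y' z' : A}
    (hab : a ^ 2 + b ^ 2 = -1) (h2 : IsUnit (2 : A))
    (h : conicVector a b x y z = conicVector a b x' y' z') : x = x' ∧ y = y' ∧ z = z' := by
  have h0 := congrFun h 0
  have h1 := congrFun h 1
  have h3 := congrFun h 2
  simp only [conicVector, Matrix.cons_val] at h0 h1 h3
  refine ⟨h2.mul_left_cancel ?_, h2.mul_left_cancel ?_, h2.mul_left_cancel ?_⟩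
  · linear_combination h3 - a * h0 - b * h1 + (x - x' - y + y') * hab
  · linear_combination h3 + a * h0 + b * h1 - (x - x' - y + y') * hab
  · linear_combination b * h0 - a * h1 + 2 * (z - z') * hab

/-- Inverting the linear change of coordinates gives `x`, `y`, `z`. If `x` and `y` both lay in the
maximal ideal, so would `z` by `x * y = z²`, and then all of `v`, contradicting primitivity. -/
theorem exists_conicVector {A : Type*} [CommRing A] [IsLocalRing A] {a b : A}
    (hab : a ^ 2 + b ^ 2 = -1) (h2 : IsUnit (2 : A)) {v : Fin 3 → A}
    (hv : v ∈ primitiveIsotropic A) :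
    ∃ x y z, conicVector a b x y z = v ∧ x * y = z ^ 2 ∧ (IsUnit x ∨ IsUnit y) := by
  obtain ⟨h, hh⟩ := h2.exists_right_inv
  obtain ⟨hiso, w, hw⟩ := hv
  set x := h * (v 2 - a * v 0 - b * v 1) with hx
  set y := h * (v 2 + a * v 0 + b * v 1) with hy
  set z := h * (b * v 0 - a * v 1) with hz
  have hvec : conicVector a b x y z = v := by
    ext i
    fin_cases i
    · simp [conicVector, hx, hy, hz]
      linear_combination (-2 * h * v 0) * hab + v 0 * hh
    · simp [conicVector, hx, hy, hz]
      linear_combination (-2 * h * v 1) * hab + v 1 * hh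
    · simp [conicVector, hx, hy]
      linear_combination v 2 * hh
  have hxy : x * y = z ^ 2 := by
    simp only [dotProduct, Fin.sum_univ_three] at hiso
    rw [hx, hy, hz]
    linear_combination h ^ 2 * hiso - h ^ 2 * (v 0 ^ 2 + v 1 ^ 2) * hab
  refine ⟨x, y, z, hvec, hxy, ?_⟩
  by_contra! hxyu
  let I := IsLocalRing.maximalIdeal A
  have hxI : x ∈ I := (IsLocalRing.mem_maximalIdeal _).2 hxyu.1
  have hyI : y ∈ I := (IsLocalRing.mem_maximalIdeal _).2 hxyu.2
  have hzI : z ∈ I := by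
    refine Ideal.IsPrime.mem_of_pow_mem (IsLocalRing.maximalIdeal.isMaximal A).isPrime 2 ?_
    rw [← hxy]
    exact I.mul_mem_right _ hxI
  have hvI : ∀ i, v i ∈ I := fun i => by
    rw [← hvec]
    have h1 := I.sub_mem hyI hxI
    have h2 := I.mul_mem_left 2 hzI
    fin_cases i
    · exact I.neg_mem (I.add_mem (I.mul_mem_left _ h1) (I.mul_mem_left _ h2))
    · exact I.neg_mem (I.sub_mem (I.mul_mem_left _ h1) (I.mul_mem_left _ h2))
    · exact I.add_mem hxI hyI
  refine (Ideal.ne_top_iff_one I).1 (IsLocalRing.maximalIdeal.isMaximal A).ne_top ?_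
  rw [← hw]
  exact I.sum_mem fun i _ => I.mul_mem_left _ (hvI i)

/-- If `x` is a unit, `z` is free and `y = z² / x`. Otherwise `y` is a unit, `x = z² / y`, and `z`
ranges over the nonunits. -/
theorem ncard_primitiveIsotropic_of_isLocalRing {A : Type*} [CommRing A] [IsLocalRing A] [Finite A]
    {a b : A} (hab : a ^ 2 + b ^ 2 = -1) (h2 : IsUnit (2 : A)) :
    (primitiveIsotropic A).ncard =
      Nat.card Aˣ * (Nat.card A + Nat.card {z : A // ¬ IsUnit z}) := by
  have hinl : ∀ (u : Aˣ) (z : A), (u : A) * (z ^ 2 * ↑u⁻¹) = z ^ 2 := fun u z => by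
    rw [mul_comm, mul_assoc, Units.inv_mul, mul_one]
  have hinr : ∀ (u : Aˣ) (z : A), z ^ 2 * ↑u⁻¹ * (u : A) = z ^ 2 := fun u z => by
    rw [mul_assoc, Units.inv_mul, mul_one]
  let F : (Aˣ × A) ⊕ (Aˣ × {z : A // ¬ IsUnit z}) → primitiveIsotropic A :=
    Sum.elim
      (fun s => ⟨conicVector a b s.1 (s.2 ^ 2 * ↑s.1⁻¹) s.2,
        conicVector_mem_primitiveIsotropic hab h2 (hinl _ _) (.inl s.1.isUnit)⟩)
      (fun s => ⟨conicVector a b (s.2.1 ^ 2 * ↑s.1⁻¹) s.1 s.2.1,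
        conicVector_mem_primitiveIsotropic hab h2 (hinr _ _) (.inr s.1.isUnit)⟩)
  have hnu : ∀ (u : Aˣ) (z : A), IsUnit (z ^ 2 * (↑u⁻¹ : A)) → IsUnit z := fun u z h =>
    (isUnit_pow_iff two_ne_zero).1 (isUnit_of_mul_isUnit_left h)
  have hF : Function.Bijective F := by
    constructor
    · rintro (⟨u, z⟩ | ⟨u, z, hz⟩) (⟨u', z'⟩ | ⟨u', z', hz'⟩) h <;>
        obtain ⟨hx, hy, hzz⟩ := conicVector_injective hab h2 (congrArg Subtype.val h)
      · obtain rfl : u = u' := Units.ext hx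
        obtain rfl : z = z' := hzz
        rfl
      · exact absurd (hnu u' z' (hx ▸ u.isUnit)) hz'
      · exact absurd (hnu u z (hx ▸ u'.isUnit)) hz
      · obtain rfl : u = u' := Units.ext hy
        obtain rfl : z = z' := hzz
        rfl
    · rintro ⟨v, hv⟩
      obtain ⟨x, y, z, rfl, hxy, hu⟩ := exists_conicVector hab h2 hv
      by_cases hx : IsUnit x
      · obtain ⟨u, rfl⟩ := hx
        refine ⟨.inl (u, z), Subtype.ext ?_⟩
        have : y = z ^ 2 * ↑u⁻¹ := by rw [← hxy, mul_comm, Units.inv_mul_cancel_left]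
        exact this ▸ rfl
      · obtain ⟨u, rfl⟩ := hu.resolve_left hx
        have hxz : x = z ^ 2 * ↑u⁻¹ := by rw [← hxy, Units.mul_inv_cancel_right]
        refine ⟨.inr (u, ⟨z, fun hz => hx ?_⟩), Subtype.ext ?_⟩
        · rw [hxz]; exact (hz.pow 2).mul u⁻¹.isUnit
        · change conicVector a b (z ^ 2 * ↑u⁻¹) u z = _
          rw [← hxz]
  rw [← Nat.card_coe_set_eq, ← Nat.card_congr (Equiv.ofBijective F hF), Nat.card_sum, Nat.card_prod,
    Nat.card_prod, mul_add]

theorem isLocalRing_zmod_prime_pow {p r : ℕ} (hp : p.Prime) (hr : r ≠ 0) :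
    IsLocalRing (ZMod (p ^ r)) := by
  have : Fact p.Prime := ⟨hp⟩
  have : Fact (1 < p ^ r) := ⟨Nat.one_lt_pow hr hp.one_lt⟩
  exact IsLocalRing.of_surjective' (PadicInt.toZModPow (p := p) r) (ZMod.ringHom_surjective _)

theorem card_nonunits_zmod_prime_pow {p r : ℕ} (hp : p.Prime) (hr : r ≠ 0) :
    Nat.card {z : ZMod (p ^ r) // ¬ IsUnit z} = p ^ (r - 1) := by
  classical
  have : NeZero (p ^ r) := ⟨pow_ne_zero _ hp.ne_zero⟩
  have h1 : Nat.card {z : ZMod (p ^ r) // IsUnit z} = (p ^ r).totient := by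
    rw [← ZMod.card_units_eq_totient, ← Nat.card_eq_fintype_card]
    exact Nat.card_congr (Equiv.ofBijective
      (fun u : (ZMod (p ^ r))ˣ => (⟨u, u.isUnit⟩ : {z : ZMod (p ^ r) // IsUnit z}))
      ⟨fun u v h => Units.ext (congrArg Subtype.val h), fun ⟨z, u, hu⟩ => ⟨u, Subtype.ext hu⟩⟩).symm
  have h2 := Nat.card_congr (Equiv.sumCompl fun z : ZMod (p ^ r) => IsUnit z)
  rw [Nat.card_sum, h1, Nat.card_zmod, Nat.totient_prime_pow hp (Nat.pos_of_ne_zero hr)] at h2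
  obtain ⟨k, rfl⟩ := Nat.exists_eq_succ_of_ne_zero hr
  obtain ⟨l, rfl⟩ := Nat.exists_eq_succ_of_ne_zero hp.ne_zero
  simp only [Nat.succ_eq_add_one, Nat.add_sub_cancel] at h2 ⊢
  rw [pow_succ (l + 1) k, mul_add, mul_one] at h2
  exact Nat.add_left_cancel h2

theorem cubicCSLCount_prime_pow {p r : ℕ} (hp : p.Prime) (hp2 : p ≠ 2) (hr : r ≠ 0) :
    cubicCSLCount (p ^ r) = (p + 1) * p ^ (r - 1) := by
  have hodd : Odd (p ^ r) := (hp.odd_of_ne_two hp2).pow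
  have : NeZero (p ^ r) := ⟨pow_ne_zero _ hp.ne_zero⟩
  have := isLocalRing_zmod_prime_pow hp hr
  obtain ⟨a, b, hab⟩ := exists_sq_add_sq_eq_neg_one hodd
  have h2 : IsUnit (2 : ZMod (p ^ r)) := by
    have := (ZMod.isUnit_iff_coprime 2 (p ^ r)).2 (Nat.coprime_two_left.2 hodd)
    exact_mod_cast this
  apply Nat.eq_of_mul_eq_mul_right (Nat.totient_pos.2 hodd.pos)
  rw [cubicCSLCount_mul_totient hodd, ncard_primitiveIsotropic_of_isLocalRing hab h2,
    card_nonunits_zmod_prime_pow hp hr, Nat.card_zmod, Nat.card_eq_fintype_card,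
    ZMod.card_units_eq_totient]
  obtain ⟨k, rfl⟩ := Nat.exists_eq_succ_of_ne_zero hr
  simp only [Nat.succ_eq_add_one, Nat.add_sub_cancel]
  ring

theorem cubicCSLCount_one : cubicCSLCount 1 = 1 := by
  have h := cubicCSLCount_mul_totient odd_one
  rw [Nat.totient_one, mul_one] at h
  rw [h, Set.ncard_eq_one]
  -- Over the zero ring `ZMod 1` the zero vector counts as primitive, since `0 = 1`.
  exact ⟨0, Set.eq_singleton_iff_unique_mem.2
    ⟨⟨Subsingleton.elim _ _, 0, Subsingleton.elim _ _⟩, fun _ _ => Subsingleton.elim _ _⟩⟩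

theorem finite_cslsOfIndex_integerLattice_three (m : ℕ) :
    (cslsOfIndex (integerLattice 3) m).Finite := by
  by_cases hm : Odd m
  · rw [cslsOfIndex_eq_image hm]
    exact (finite_primitiveIsotropic hm.pos.ne').image _
  · rw [cslsOfIndex_eq_empty hm]
    exact Set.finite_empty

/-! ### Dirichlet series, Euler product and zeta functions -/

/-- At an odd prime power the count `p^r + p^(r-1)` is a partial sum of the divisors. The bound
gives absolute convergence, as the series of `σ 1` is a convolution of two series summable for `Re s
> 2`. -/
theorem cubicCSLCount_le_sigma (m : ℕ) : cubicCSLCount m ≤ σ 1 m := by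
  induction m using Nat.recOnPosPrimePosCoprime with
  | zero => rw [cubicCSLCount_eq_zero (by simp)]; exact Nat.zero_le _
  | one => rw [cubicCSLCount_one, ArithmeticFunction.sigma_one]
  | prime_pow p n hp hn =>
    by_cases hp2 : p = 2
    · rw [cubicCSLCount_eq_zero]
      · exact Nat.zero_le _
      · rw [hp2, Nat.not_odd_iff_even, Nat.even_pow]
        exact ⟨even_two, hn.ne'⟩
    · rw [cubicCSLCount_prime_pow hp hp2 hn.ne', ArithmeticFunction.sigma_one_apply_prime_pow hp]
      obtain ⟨k, rfl⟩ := Nat.exists_eq_succ_of_ne_zero hn.ne'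
      rw [Finset.sum_range_succ, Finset.sum_range_succ]
      simp only [Nat.succ_eq_add_one, Nat.add_sub_cancel]
      rw [pow_succ]
      nlinarith [Nat.zero_le (∑ x ∈ Finset.range k, p ^ x)]
  | coprime a b ha hb hab iha ihb =>
    rw [cubicCSLCount_mul hab, ArithmeticFunction.isMultiplicative_sigma.map_mul_of_coprime hab]
    exact Nat.mul_le_mul iha ihb

theorem lseriesSummable_sigma_one {s : ℂ} (hs : 2 < s.re) :
    LSeriesSummable (fun n => ((σ 1 n : ℕ) : ℂ)) s := by
  have h1 : LSeriesSummable (fun _ => (1 : ℂ)) s :=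
    LSeriesSummable_of_bounded_of_one_lt_re (m := 1) (by simp) (by linarith)
  have h2 : LSeriesSummable (fun n => (n : ℂ)) s :=
    LSeriesSummable_of_le_const_mul_rpow hs ⟨1, fun n _ => by norm_num⟩
  have h := h1.convolution h2
  rw [LSeries.convolution_def] at h
  refine (LSeriesSummable_congr s fun {n} _ => ?_).1 h
  rw [ArithmeticFunction.sigma_one_apply, Nat.cast_sum,
    ← Nat.sum_divisorsAntidiagonal' (f := fun _ d => (d : ℂ))]
  simp

theorem lseriesSummable_cubicCSLCount {s : ℂ} (hs : 2 < s.re) :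
    LSeriesSummable (fun m => (cubicCSLCount m : ℂ)) s := by
  refine Summable.of_norm_bounded (lseriesSummable_sigma_one hs).norm fun n =>
    LSeries.norm_term_le s ?_
  simpa using cubicCSLCount_le_sigma n

theorem natCast_pow_cpow (p e : ℕ) (s : ℂ) : ((p ^ e : ℕ) : ℂ) ^ s = ((p : ℂ) ^ s) ^ e := by
  induction e with
  | zero => simp
  | succ k ih => rw [pow_succ, Nat.cast_mul, Complex.natCast_mul_natCast_cpow, ih, pow_succ]

theorem norm_natCast_cpow_lt_one {p : ℕ} (hp : 1 < p) {s : ℂ} (hs : s.re < 0) :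
    ‖(p : ℂ) ^ s‖ < 1 := by
  rw [Complex.norm_natCast_cpow_of_pos (by lia)]
  exact Real.rpow_lt_one_of_one_lt_of_neg (by exact_mod_cast hp) hs

theorem natCast_cpow_one_sub {p : ℕ} (hp : p ≠ 0) (s : ℂ) :
    (p : ℂ) ^ (1 - s) = p * (p : ℂ) ^ (-s) := by
  rw [sub_eq_add_neg, Complex.cpow_add _ _ (by exact_mod_cast hp), Complex.cpow_one]

theorem term_cubicCSLCount_pow {p : ℕ} (hp : p ≠ 0) (e : ℕ) (s : ℂ) :
    LSeries.term (fun m => (cubicCSLCount m : ℂ)) s (p ^ e) =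
      cubicCSLCount (p ^ e) * ((p : ℂ) ^ (-s)) ^ e := by
  rw [LSeries.term_of_ne_zero (pow_ne_zero _ hp), natCast_pow_cpow, Complex.cpow_neg, inv_pow,
    div_eq_mul_inv]

theorem tsum_term_cubicCSLCount_two (s : ℂ) :
    ∑' e, LSeries.term (fun m => (cubicCSLCount m : ℂ)) s (2 ^ e) = 1 := by
  rw [tsum_eq_single 0]
  · simp [cubicCSLCount_one]
  · intro e he
    rw [term_cubicCSLCount_pow two_ne_zero, cubicCSLCount_eq_zero, Nat.cast_zero, zero_mul]
    rw [Nat.not_odd_iff_even, Nat.even_pow]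
    exact ⟨even_two, he⟩

theorem tsum_eq_of_geometric_tail {f : ℕ → ℂ} {p x : ℂ} (hx : ‖p * x‖ < 1) (h0 : f 0 = 1)
    (hf : ∀ e, f (e + 1) = (p + 1) * x * (p * x) ^ e) : ∑' e, f e = (1 + x) / (1 - p * x) := by
  have hy : 1 - p * x ≠ 0 := fun h => by
    rw [← sub_eq_zero.1 h] at hx; simp at hx
  have hg := (hasSum_geometric_of_norm_lt_one hx).mul_left ((p + 1) * x)
  simp only [← hf] at hg
  rw [(hasSum_nat_add_iff 1).1 hg |>.tsum_eq, Finset.sum_range_one, h0]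
  field_simp
  ring

theorem tsum_term_cubicCSLCount {p : ℕ} (hp : p.Prime) (hp2 : p ≠ 2) {s : ℂ} (hs : 2 < s.re) :
    ∑' e, LSeries.term (fun m => (cubicCSLCount m : ℂ)) s (p ^ e) =
      (1 + (p : ℂ) ^ (-s)) / (1 - (p : ℂ) ^ (1 - s)) := by
  have hy : ‖(p : ℂ) ^ (1 - s)‖ < 1 :=
    norm_natCast_cpow_lt_one hp.one_lt (by rw [Complex.sub_re, Complex.one_re]; linarith)
  rw [natCast_cpow_one_sub hp.ne_zero] at hy ⊢
  refine tsum_eq_of_geometric_tail hy ?_ fun e => ?_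
  · simp [cubicCSLCount_one]
  · rw [term_cubicCSLCount_pow hp.ne_zero, cubicCSLCount_prime_pow hp hp2 (by lia : e + 1 ≠ 0),
      Nat.add_sub_cancel, Nat.cast_mul, Nat.cast_pow, Nat.cast_add, Nat.cast_one, mul_pow, pow_succ]
    ring

theorem hasProd_cubicCSLCount {s : ℂ} (hs : 2 < s.re) :
    HasProd (Set.mulIndicator {p : ℕ | p.Prime ∧ p ≠ 2}
        fun p => (1 + (p : ℂ) ^ (-s)) / (1 - (p : ℂ) ^ (1 - s)))
      (LSeries (fun m => (cubicCSLCount m : ℂ)) s) := by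
  have h := EulerProduct.eulerProduct_hasProd_mulIndicator
    (f := LSeries.term (fun m => (cubicCSLCount m : ℂ)) s) (by simp [cubicCSLCount_one])
    (fun {m n} hmn => ?_) (lseriesSummable_cubicCSLCount hs).norm (LSeries.term_zero _ _)
  · refine h.congr_fun fun p => ?_
    by_cases hp : p.Prime
    · by_cases hp2 : p = 2
      · subst hp2
        rw [Set.mulIndicator_of_notMem (by simp), Set.mulIndicator_of_mem (by exact hp),
          tsum_term_cubicCSLCount_two]
      · rw [Set.mulIndicator_of_mem (by exact ⟨hp, hp2⟩), Set.mulIndicator_of_mem (by exact hp),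
          tsum_term_cubicCSLCount hp hp2 hs]
    · rw [Set.mulIndicator_of_notMem (by exact fun h => hp h.1),
        Set.mulIndicator_of_notMem (by exact hp)]
  -- `LSeries.term` is 0 at index 0 by convention, so zero arguments are treated apart.
  · rcases eq_or_ne m 0 with rfl | hm
    · simp
    rcases eq_or_ne n 0 with rfl | hn
    · simp
    rw [LSeries.term_of_ne_zero hm, LSeries.term_of_ne_zero hn,
      LSeries.term_of_ne_zero (mul_ne_zero hm hn), cubicCSLCount_mul hmn, Nat.cast_mul, Nat.cast_mul,
      Complex.natCast_mul_natCast_cpow]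
    ring

theorem riemannZeta_hasProd_mulIndicator {s : ℂ} (hs : 1 < s.re) :
    HasProd (Set.mulIndicator {p : ℕ | p.Prime} fun p => (1 - (p : ℂ) ^ (-s))⁻¹)
      (riemannZeta s) := by
  rw [← hasProd_subtype_iff_mulIndicator]
  exact riemannZeta_eulerProduct_hasProd hs

theorem lseries_cubicCSLCount {s : ℂ} (hs : 2 < s.re) :
    LSeries (fun m => (cubicCSLCount m : ℂ)) s =
      (1 - (2 : ℂ) ^ (1 - s)) / (1 + (2 : ℂ) ^ (-s)) *
        (riemannZeta s * riemannZeta (s - 1) / riemannZeta (2 * s)) := by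
  have hs2 : 1 < (2 * s).re := by simp; linarith
  have hx : ∀ p : ℕ, p.Prime → 1 - (p : ℂ) ^ (-s) ≠ 0 ∧ 1 + (p : ℂ) ^ (-s) ≠ 0 := fun p hp => by
    have h := norm_natCast_cpow_lt_one hp.one_lt (s := -s) (by rw [Complex.neg_re]; linarith)
    constructor <;> intro h0
    · rw [← sub_eq_zero.1 h0] at h; simp at h
    · rw [← neg_eq_of_add_eq_zero_right h0] at h; simp at h
  have hy : ∀ p : ℕ, p.Prime → 1 - (p : ℂ) ^ (1 - s) ≠ 0 := fun p hp h0 => by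
    have h := norm_natCast_cpow_lt_one hp.one_lt (s := 1 - s)
      (by rw [Complex.sub_re, Complex.one_re]; linarith)
    rw [← sub_eq_zero.1 h0] at h; simp at h
  -- `c` is the factor missing at the prime 2; inserting it makes the product run over all primes.
  set c : ℂ := (1 + (2 : ℂ) ^ (-s)) / (1 - (2 : ℂ) ^ (1 - s)) with hc
  have h2 : HasProd (fun p : ℕ => if p = 2 then c else 1) c := hasProd_ite_eq 2 c
  have hl := ((hasProd_cubicCSLCount hs).mul h2).mul (riemannZeta_hasProd_mulIndicator hs2)
  have hr := (riemannZeta_hasProd_mulIndicator (s := s) (by linarith)).mul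
    (riemannZeta_hasProd_mulIndicator (s := s - 1)
      (by rw [Complex.sub_re, Complex.one_re]; linarith))
  have hdouble : ∀ p : ℕ, (p : ℂ) ^ (-(2 * s)) = ((p : ℂ) ^ (-s)) ^ 2 := fun p => by
    rw [← Complex.cpow_nat_mul]; congr 1; push_cast; ring
  -- Cross-multiplying avoids dividing infinite products. With `x = p^(-s)` and `y = p^(1-s)`, the
  -- factors agree because `1 - x² = (1 - x)(1 + x)`.
  have key : LSeries (fun m => (cubicCSLCount m : ℂ)) s * c * riemannZeta (2 * s) =
      riemannZeta s * riemannZeta (s - 1) := by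
    refine hl.unique (hr.congr_fun fun p => ?_)
    by_cases hp : p.Prime
    swap
    · have hp2 : p ≠ 2 := fun h => hp (h ▸ Nat.prime_two)
      simp [hp, hp2]
    have hpm : p ∈ {p : ℕ | p.Prime} := hp
    obtain ⟨hx1, hx1'⟩ := hx p hp
    have hy1 := hy p hp
    have hxx : 1 - ((p : ℂ) ^ (-s)) ^ 2 ≠ 0 := by
      rw [show 1 - ((p : ℂ) ^ (-s)) ^ 2 = (1 - (p : ℂ) ^ (-s)) * (1 + (p : ℂ) ^ (-s)) by ring]
      exact mul_ne_zero hx1 hx1'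
    have hF : (Set.mulIndicator {p : ℕ | p.Prime ∧ p ≠ 2}
        (fun p => (1 + (p : ℂ) ^ (-s)) / (1 - (p : ℂ) ^ (1 - s))) p * if p = 2 then c else 1) =
        (1 + (p : ℂ) ^ (-s)) / (1 - (p : ℂ) ^ (1 - s)) := by
      by_cases hp2 : p = 2
      · simp [hp2, hc]
      · rw [Set.mulIndicator_of_mem (by exact ⟨hp, hp2⟩), if_neg hp2, mul_one]
    rw [hF, Set.mulIndicator_of_mem hpm, Set.mulIndicator_of_mem hpm, Set.mulIndicator_of_mem hpm,
      hdouble, neg_sub]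
    generalize (p : ℂ) ^ (-s) = x at *
    generalize (p : ℂ) ^ (1 - s) = y at *
    rw [div_mul_eq_mul_div, div_eq_iff hy1, mul_assoc, inv_mul_cancel₀ hy1, mul_one,
      mul_inv_eq_iff_eq_mul₀ hxx, inv_mul_eq_div, eq_div_iff hx1]
    ring
  have hx2 := (hx 2 Nat.prime_two).2
  have hy2 := hy 2 Nat.prime_two
  push_cast at hx2 hy2
  have hz : riemannZeta (2 * s) ≠ 0 := riemannZeta_ne_zero_of_one_lt_re hs2
  rw [← key, hc, mul_div_assoc, div_self hz, mul_one, mul_div_assoc', mul_comm, div_mul_div_comm,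
    eq_div_iff (mul_ne_zero hy2 hx2)]
  ring

theorem cubicCSLCount_prime {p : ℕ} (hp : p.Prime) (hp2 : p ≠ 2) : cubicCSLCount p = p + 1 := by
  simpa using cubicCSLCount_prime_pow hp hp2 one_ne_zero

theorem mainTheorem4 :
    -- the numbers `f(m)` are finite
    (∀ m : ℕ, (cslsOfIndex (integerLattice 3) m).Finite) ∧
    -- multiplicativity
    cubicCSLCount 1 = 1 ∧
    (∀ m n : ℕ, 0 < m → 0 < n → m.Coprime n →
      cubicCSLCount (m * n) = cubicCSLCount m * cubicCSLCount n) ∧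
    -- values at even numbers and at powers of odd primes
    (∀ n : ℕ, 0 < n → cubicCSLCount (2 * n) = 0) ∧
    (∀ p r : ℕ, p.Prime → p ≠ 2 → 1 ≤ r → cubicCSLCount (p ^ r) = (p + 1) * p ^ (r - 1)) ∧
    -- the Dirichlet series, its Euler product, and its expression through the zeta function
    (∀ s : ℂ, 2 < s.re →
      LSeriesSummable (fun m => (cubicCSLCount m : ℂ)) s ∧
      HasProd (fun p : {p : ℕ // p.Prime ∧ p ≠ 2} =>
          (1 + ((p : ℕ) : ℂ) ^ (-s)) / (1 - ((p : ℕ) : ℂ) ^ (1 - s)))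
        (LSeries (fun m => (cubicCSLCount m : ℂ)) s) ∧
      LSeries (fun m => (cubicCSLCount m : ℂ)) s =
        (1 - (2 : ℂ) ^ (1 - s)) / (1 + (2 : ℂ) ^ (-s)) *
          (riemannZeta s * riemannZeta (s - 1) / riemannZeta (2 * s))) ∧
    -- the first coefficients
    (cubicCSLCount 3 = 4 ∧ cubicCSLCount 5 = 6 ∧ cubicCSLCount 7 = 8 ∧ cubicCSLCount 9 = 12 ∧
      cubicCSLCount 11 = 12 ∧ cubicCSLCount 13 = 14 ∧ cubicCSLCount 15 = 24 ∧
      cubicCSLCount 17 = 18 ∧ cubicCSLCount 19 = 20 ∧ cubicCSLCount 21 = 32 ∧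
      cubicCSLCount 23 = 24 ∧ cubicCSLCount 25 = 30) := by 
  refine ⟨finite_cslsOfIndex_integerLattice_three, cubicCSLCount_one,
    fun m n _ _ h => cubicCSLCount_mul h, fun n _ => cubicCSLCount_eq_zero (by simp),
    fun p r hp hp2 hr => cubicCSLCount_prime_pow hp hp2 (by lia), fun s hs =>
      ⟨lseriesSummable_cubicCSLCount hs, ?_, lseries_cubicCSLCount hs⟩, ?_⟩
  · exact (hasProd_subtype_iff_mulIndicator
      (s := {p : ℕ | p.Prime ∧ p ≠ 2})).2 (hasProd_cubicCSLCount hs)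
  · have h3 : cubicCSLCount 3 = 4 := cubicCSLCount_prime (by norm_num) (by norm_num)
    have h5 : cubicCSLCount 5 = 6 := cubicCSLCount_prime (by norm_num) (by norm_num)
    have h7 : cubicCSLCount 7 = 8 := cubicCSLCount_prime (by norm_num) (by norm_num)
    refine ⟨h3, h5, h7, ?_, ?_, ?_, ?_, ?_, ?_, ?_, ?_, ?_⟩
    · exact cubicCSLCount_prime_pow (p := 3) (r := 2) (by norm_num) (by norm_num) two_ne_zero
    · exact cubicCSLCount_prime (by norm_num) (by norm_num)
    · exact cubicCSLCount_prime (by norm_num) (by norm_num)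
    · exact (cubicCSLCount_mul (m := 3) (n := 5) (by norm_num)).trans (by rw [h3, h5])
    · exact cubicCSLCount_prime (by norm_num) (by norm_num)
    · exact cubicCSLCount_prime (by norm_num) (by norm_num)
    · exact (cubicCSLCount_mul (m := 3) (n := 7) (by norm_num)).trans (by rw [h3, h7])
    · exact cubicCSLCount_prime (by norm_num) (by norm_num)
    · exact cubicCSLCount_prime_pow (p := 5) (r := 2) (by norm_num) (by norm_num) two_ne_zero
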